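/- **Conventions.** A function $u:\mathbb R_{\ge 0}\to\mathbb R_{\ge 1}$ is *admissible* if it is nondecreasing, doubling ($\limsup_{r\to\infty}u(2r)/u(r)<\infty$) and sublinear ($u(r)/r\to 0$ as $r\to\infty$). Metric spaces are pointed, with base point $o$, and $|x|$ denotes the distance from $x$ to the base point. For $\underline\lambda,\overline\lambda>0$, a map $f:X\to Y$ is a $(\underline\lambda,\overline\lambda,O(u))$-*sublinearly biLipschitz equivalence* if there is a nondecreasing $v=O(u)$ with $$\underline\lambda\,d(x,x')-v(\max(|x|,|x'|))\le d(f(x),f(x'))\le\overline\lambda\, d(x,x')+v(\max(|x|,|x'|))\qquad(x,x'\in X)$$ and $d(y,f(X))=O(u(|y|))$ for $y\in Y$. Maps $f,g:X\to Y$ are $O(u)$-*close* if $d(f(x),g(x))=O(u(|x|))$. The Gromov product is $(x\mid y)_o=\frac12(d(x,o)+d(y,o)-d(x,y))$, and $X$ is $\delta$-*hyperbolic* if $(x_1\mid x_3)_{x_0}\ge\min\{(x_1\mid x_2)_{x_0},(x_2\mid x_3)_{x_0}\}-\delta$ for all $x_0,\dots,x_3\in X$. The boundary $\partial_\infty X$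 is the set of sequences $(x_n)$ with $(x_n\mid x_m)_o\to\infty$ as $n,m\to\infty$, modulo $(x_n)\sim(y_n)$ iff $(x_n\mid y_n)_o\to\infty$. For $\xi,\eta\in\partial_\infty X$, let $(\xi\mid\eta)_o$ be the infimum of $\liminf_n(x_n\mid y_n)_o$ over sequences representing $\xi$ and $\eta$. For $\nu>1$ with $\nu^\delta\le 2$, the *visual metric* of parameter $\nu$ on the boundary of a $\delta$-hyperbolic space is $$d_\nu(\xi,\xi')=\inf\Big\{\sum_{i=1}^n\nu^{-(\xi_{i-1}\mid\xi_i)_o}:\ n\ge 1,\ \xi_0=\xi,\ \xi_n=\xi'\Big\}.$$ For distinct points $\xi_1,\dots,\xi_4$ of a metric space $(\Xi,\varrho)$ put $[\xi_i]=\dfrac{\varrho(\xi_1,\xi_3)\varrho(\xi_2,\xi_4)}{\varrho(\xi_1,\xi_4)\varrho(\xi_2,\xi_3)}$, and $\log_\nu^+ s=\max(0,\log_\nu s)$. A homeomorphism $\varphi:\Xi\to\Psi$ of metric spaces is $(\underline\alpha,\overline\alpha,O(u))$-*sublinearly quasiMöbius* if there are $v=O(u)$, $\nu>1$ and $\mathcal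 E>0$ such that for all $\xi_1,\dots,\xi_4\in\Xi$ with $0<\varrho(\xi_i,\xi_j)<\mathcal E$ for $i\ne j$, $$\underline\alpha\log_\nu^+[\xi_i]-v\Big(\sup_{i\ne j}-\log_\nu\varrho(\xi_i,\xi_j)\Big)\le\log_\nu^+[\varphi(\xi_i)]\le\overline\alpha\log_\nu^+[\xi_i]+v\Big(\sup_{i\ne j}-\log_\nu\varrho(\xi_i,\xi_j)\Big).$$ **Theorem.** Let $u$ be an admissible function, let $\underline\lambda,\overline\lambda>0$, let $X,Y$ be pointed proper geodesic $\delta$-hyperbolic metric spaces, and let $f:X\to Y$ be a $(\underline\lambda,\overline\lambda,O(u))$-sublinearly biLipschitz equivalence. Let $\nu>1$ with $\nu^\delta\le 2$, and equip $\partial_\infty X$ and $\partial_\infty Y$ with their visual metrics of parameter $\nu$. Then there is a homeomorphism $\varphi=\partial_\infty f:\partial_\infty X\to\partial_\infty Y$ such that: 1. $\varphi$ is induced by $f$, and by every map $g:X\to Y$ that is $O(u)$-close to $f$: if $(x_n)$ represents $\xi\in\partial_\infty X$, then $(g(x_n))$ represents $\varphi(\xi)$; 2. $\varphi$ is a $(\underline\lambda,\overline\lambda,O(u))$-sublinearly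 quasiMöbius homeomorphism; 3. there are $v=O(u)$ and $\mathcal E>0$ such that for all distinct $\xi_1,\dots,\xi_4\in\partial_\infty X$ at pairwise distances less than $\mathcal E$, $$\underline\lambda\log_\nu^+[\xi_i]-v\Big(\sup_{i\ne j}(\xi_i\mid\xi_j)_o\Big)\le\log_\nu^+[\varphi(\xi_i)]\le\overline\lambda\log_\nu^+[\xi_i]+v\Big(\sup_{i\ne j}(\xi_i\mid\xi_j)_o\Big).$$ -/

import Mathlib

open Set Filter Topology Asymptotics
open scoped NNReal

noncomputable section

namespace SublinearMobius

universe w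

/-! ### Admissible functions and sublinearly biLipschitz equivalences -/

/-- Admissible functions `u : ℝ≥0 → ℝ≥1`: nondecreasing, doubling and sublinear. They are encoded as
functions on `ℝ` of which only the values on `[0, ∞)` matter. -/
structure Admissible (u : ℝ → ℝ) : Prop where
  one_le : ∀ r, 0 ≤ r → 1 ≤ u r
  mono : MonotoneOn u (Ici 0)
  doubling : (fun r => u (2 * r)) =O[atTop] u
  sublinear : u =o[atTop] (fun r => r)

/-- `f : (X, o) → (Y, p)` is a `(lamLow, lamUp, O(u))`-sublinearly biLipschitz equivalence. -/
structure IsSBE {X Y : Type*} [MetricSpace X] [MetricSpace Y] (o : X) (p : Y)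
    (lamLow lamUp : ℝ) (u : ℝ → ℝ) (f : X → Y) : Prop where
  lipschitz : ∃ v : ℝ → ℝ, MonotoneOn v (Ici 0) ∧ v =O[atTop] u ∧
    ∀ x x', dist (f x) (f x') ≤ lamUp * dist x x' + v (max (dist o x) (dist o x'))
  expansive : ∃ v : ℝ → ℝ, MonotoneOn v (Ici 0) ∧ v =O[atTop] u ∧
    ∀ x x', lamLow * dist x x' - v (max (dist o x) (dist o x')) ≤ dist (f x) (f x')
  surjective : ∃ C : ℝ, ∀ y, Metric.infDist y (range f) ≤ C * u (dist p y)

/-- `f` and `g` are `O(u)`-close. -/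
def IsClose {X Y : Type*} [MetricSpace X] [MetricSpace Y] (o : X) (u : ℝ → ℝ) (f g : X → Y) :
    Prop :=
  ∃ C : ℝ, ∀ x, dist (f x) (g x) ≤ C * u (dist o x)

/-! ### Hyperbolic spaces and their Gromov boundary -/

/-- Any two points are joined by a geodesic segment. -/
def IsGeodesicSpace (X : Type*) [MetricSpace X] : Prop :=
  ∀ x y : X, ∃ c : ℝ → X, c 0 = x ∧ c (dist x y) = y ∧
    ∀ s ∈ Icc 0 (dist x y), ∀ t ∈ Icc 0 (dist x y), dist (c s) (c t) = |s - t|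

/-- The Gromov product `(x ∣ y)_o`. -/
def gromovProduct {X : Type*} [MetricSpace X] (o x y : X) : ℝ :=
  (dist x o + dist y o - dist x y) / 2

/-- Gromov's four-point definition of `δ`-hyperbolicity. -/
def IsHyperbolic (δ : ℝ) (X : Type*) [MetricSpace X] : Prop :=
  ∀ x₀ x₁ x₂ x₃ : X,
    min (gromovProduct x₀ x₁ x₂) (gromovProduct x₀ x₂ x₃) - δ ≤ gromovProduct x₀ x₁ x₃

/-- Cauchy-Gromov sequences. -/
def IsCauchyGromov {X : Type*} [MetricSpace X] (o : X) (x : ℕ → X) : Prop :=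
  Tendsto (fun q : ℕ × ℕ => gromovProduct o (x q.1) (x q.2)) atTop atTop

/-- The type of Cauchy-Gromov sequences of a pointed space. -/
def CauchyGromovSeq {X : Type*} [MetricSpace X] (o : X) : Type _ :=
  {x : ℕ → X // IsCauchyGromov o x}

/-- Two Cauchy-Gromov sequences are equivalent when `(x n ∣ y n)_o → ∞`. -/
def SeqEquiv {X : Type*} [MetricSpace X] (o : X) (x y : CauchyGromovSeq o) : Prop :=
  Tendsto (fun n => gromovProduct o (x.1 n) (y.1 n)) atTop atTop

/-- The Gromov boundary: Cauchy-Gromov sequences modulo equivalence. `SeqEquiv o` is an equivalence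
relation if `X` is hyperbolic, see `GromovBoundary.mk_eq_mk_iff`. -/
def GromovBoundary {X : Type*} [MetricSpace X] (o : X) : Type _ :=
  Quot (SeqEquiv o)

/-- The boundary point defined by a Cauchy-Gromov sequence. -/
def GromovBoundary.mk {X : Type*} [MetricSpace X] {o : X} (x : CauchyGromovSeq o) :
    GromovBoundary o :=
  Quot.mk _ x

/-- The Gromov product on the boundary: the infimum of `liminf (x n ∣ y n)_o` over all sequences
`x`, `y` that represent the two points. It takes the value `⊤` exactly on the diagonal. -/
def boundaryProduct {X : Type*} [MetricSpace X] {o : X} (ξ η : GromovBoundary o) : EReal :=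
  ⨅ (x : CauchyGromovSeq o) (y : CauchyGromovSeq o)
    (_ : GromovBoundary.mk x = ξ) (_ : GromovBoundary.mk y = η),
    liminf (fun n => ((gromovProduct o (x.1 n) (y.1 n) : ℝ) : EReal)) atTop

open scoped Classical in
/-- The visual kernel `ν ^ (-(ξ ∣ η)_o)` on the boundary (with `ν ^ (-∞) = 0`). -/
def visualKernel {X : Type*} [MetricSpace X] {o : X} (ν : ℝ) (ξ η : GromovBoundary o) : ℝ≥0 :=
  if boundaryProduct ξ η = ⊤ then 0 else Real.toNNReal (ν ^ (-(boundaryProduct ξ η).toReal))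

section Helpers

variable {X : Type*} [MetricSpace X] {o : X} {δ ν : ℝ}

theorem gromovProduct_comm (o x y : X) : gromovProduct o x y = gromovProduct o y x := by
  simp only [gromovProduct, dist_comm x y]; ring

theorem gromovProduct_nonneg (o x y : X) : 0 ≤ gromovProduct o x y := by
  have := dist_triangle x o y
  rw [dist_comm o y] at this
  unfold gromovProduct; linarith

theorem SeqEquiv.trans' (hX : IsHyperbolic δ X) {x y z : CauchyGromovSeq o}
    (h₁ : SeqEquiv o x y) (h₂ : SeqEquiv o y z) : SeqEquiv o x z := by
  refine tendsto_atTop.2 fun b => ?_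
  filter_upwards [tendsto_atTop.1 h₁ (b + δ), tendsto_atTop.1 h₂ (b + δ)] with n h h'
  have := hX o (x.1 n) (y.1 n) (z.1 n)
  have := le_min h h'
  linarith

theorem seqEquiv_equivalence (hX : IsHyperbolic δ X) : Equivalence (SeqEquiv o) where
  refl x := x.2.comp tendsto_atTop_diagonal
  symm {x y} h := by
    unfold SeqEquiv at h ⊢
    simpa only [gromovProduct_comm] using h
  trans h h' := SeqEquiv.trans' hX h h'

theorem GromovBoundary.mk_eq_mk_iff (hX : IsHyperbolic δ X) {x y : CauchyGromovSeq o} :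
    GromovBoundary.mk x = GromovBoundary.mk y ↔ SeqEquiv o x y :=
  ⟨fun h => (seqEquiv_equivalence hX).eqvGen_iff.1 (Quot.eqvGen_exact h), fun h => Quot.sound h⟩

theorem boundaryProduct_comm (ξ η : GromovBoundary o) :
    boundaryProduct ξ η = boundaryProduct η ξ := by
  unfold boundaryProduct
  rw [iInf_comm]
  refine iInf_congr fun y => iInf_congr fun x => ?_
  rw [iInf_comm]
  simp only [gromovProduct_comm]

theorem boundaryProduct_nonneg (ξ η : GromovBoundary o) : 0 ≤ boundaryProduct ξ η := by
  refine le_iInf fun x => le_iInf fun y => le_iInf fun _ => le_iInf fun _ => ?_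
  refine le_liminf_of_le (by isBoundedDefault) (Eventually.of_forall fun n => ?_)
  exact_mod_cast gromovProduct_nonneg o (x.1 n) (y.1 n)

theorem boundaryProduct_self (hX : IsHyperbolic δ X) (ξ : GromovBoundary o) :
    boundaryProduct ξ ξ = ⊤ := by
  refine eq_top_iff.2 (le_iInf fun x => le_iInf fun y => le_iInf fun hx => le_iInf fun hy => ?_)
  have h : SeqEquiv o x y := (GromovBoundary.mk_eq_mk_iff hX).1 (hx.trans hy.symm)
  refine ((EReal.tendsto_coe_atTop.comp h).liminf_eq).ge

theorem eq_of_boundaryProduct_eq_top {ξ η : GromovBoundary o} (h : boundaryProduct ξ η = ⊤) :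
    ξ = η := by
  obtain ⟨x, rfl⟩ := Quot.exists_rep ξ
  obtain ⟨y, rfl⟩ := Quot.exists_rep η
  refine Quot.sound (tendsto_atTop.2 fun b => ?_)
  have h1 : (⊤ : EReal) ≤
      liminf (fun n => ((gromovProduct o (x.1 n) (y.1 n) : ℝ) : EReal)) atTop := by
    rw [← h]
    exact iInf_le_of_le x (iInf_le_of_le y (iInf_le_of_le rfl (iInf_le_of_le rfl le_rfl)))
  have h2 : ((b : ℝ) : EReal) <
      liminf (fun n => ((gromovProduct o (x.1 n) (y.1 n) : ℝ) : EReal)) atTop :=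
    (EReal.coe_lt_top b).trans_le h1
  filter_upwards [eventually_lt_of_lt_liminf h2 (by isBoundedDefault)] with n hn
  exact (EReal.coe_lt_coe_iff.1 hn).le

theorem le_boundaryProduct (hX : IsHyperbolic δ X) {ξ η ζ : GromovBoundary o} {a : ℝ}
    (h₁ : (a : EReal) < boundaryProduct ξ η) (h₂ : (a : EReal) < boundaryProduct η ζ) :
    ((a - δ : ℝ) : EReal) ≤ boundaryProduct ξ ζ := by
  refine le_iInf fun x => le_iInf fun z => le_iInf fun hx => le_iInf fun hz => ?_
  obtain ⟨y, hy⟩ := Quot.exists_rep η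
  have h1 := h₁.trans_le (iInf_le_of_le x (iInf_le_of_le y (iInf_le_of_le hx
    (iInf_le_of_le hy le_rfl))))
  have h2 := h₂.trans_le (iInf_le_of_le y (iInf_le_of_le z (iInf_le_of_le hy
    (iInf_le_of_le hz le_rfl))))
  refine le_liminf_of_le (by isBoundedDefault) ?_
  filter_upwards [eventually_lt_of_lt_liminf h1 (by isBoundedDefault),
    eventually_lt_of_lt_liminf h2 (by isBoundedDefault)] with n hn hn'
  have h := hX o (x.1 n) (y.1 n) (z.1 n)
  have := le_min (EReal.coe_lt_coe_iff.1 hn).le (EReal.coe_lt_coe_iff.1 hn').le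
  exact_mod_cast (by linarith : a - δ ≤ gromovProduct o (x.1 n) (z.1 n))

theorem visualKernel_self (hX : IsHyperbolic δ X) (ξ : GromovBoundary o) :
    visualKernel ν ξ ξ = 0 := by
  simp [visualKernel, boundaryProduct_self hX]

theorem visualKernel_comm (ξ η : GromovBoundary o) :
    visualKernel ν ξ η = visualKernel ν η ξ := by
  simp only [visualKernel, boundaryProduct_comm ξ η]

theorem eq_of_visualKernel_eq_zero (hν : 1 < ν) {ξ η : GromovBoundary o}
    (h : visualKernel ν ξ η = 0) : ξ = η := by
  by_contra hne
  have ht : boundaryProduct ξ η ≠ ⊤ := fun ht => hne (eq_of_boundaryProduct_eq_top ht)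
  rw [visualKernel, if_neg ht, Real.toNNReal_eq_zero] at h
  exact absurd (Real.rpow_pos_of_pos (by linarith) _) (not_lt.2 h)

/-- The kernel is at most `ν ^ (-a)` iff the Gromov product is at least `a`. -/
theorem visualKernel_le_iff (hν : 1 < ν) (a : ℝ) (ξ η : GromovBoundary o) :
    (visualKernel ν ξ η : ℝ) ≤ ν ^ (-a) ↔ (a : EReal) ≤ boundaryProduct ξ η := by
  have hpos : 0 < ν := by linarith
  by_cases ht : boundaryProduct ξ η = ⊤
  · simp only [visualKernel, ht, le_top, iff_true]
    exact Real.rpow_nonneg hpos.le _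
  · have hb : boundaryProduct ξ η ≠ ⊥ :=
      ((EReal.bot_lt_zero).trans_le (boundaryProduct_nonneg ξ η)).ne'
    rw [visualKernel, if_neg ht, Real.coe_toNNReal _ (Real.rpow_nonneg hpos.le _),
      Real.rpow_le_rpow_left_iff hν, neg_le_neg_iff, ← EReal.coe_le_coe_iff,
      EReal.coe_toReal ht hb]

theorem visualKernel_quasi (hX : IsHyperbolic δ X) (hν : 1 < ν) (hνδ : ν ^ δ ≤ 2)
    (ξ η ζ : GromovBoundary o) :
    visualKernel ν ξ ζ ≤ 2 * max (visualKernel ν ξ η) (visualKernel ν η ζ) := by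
  have hpos : 0 < ν := by linarith
  rw [← NNReal.coe_le_coe]
  push_cast
  refine le_of_forall_gt_imp_ge_of_dense fun c hc => ?_
  have hm0 : 0 ≤ 2 * max (visualKernel ν ξ η : ℝ) (visualKernel ν η ζ) := by positivity
  have hc0 : 0 < c := hm0.trans_lt hc
  obtain ⟨e, he1, he2⟩ := exists_between (show max (visualKernel ν ξ η : ℝ)
    (visualKernel ν η ζ) < c / 2 by linarith)
  have he0 : 0 < e := lt_of_le_of_lt (by positivity) he1
  have hrep : ∀ t : ℝ, 0 < t → ν ^ (-(-Real.logb ν t)) = t := fun t ht => by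
    rw [neg_neg, Real.rpow_logb hpos hν.ne' ht]
  have hlt : -Real.logb ν (c / 2) < -Real.logb ν e :=
    neg_lt_neg (Real.logb_lt_logb hν he0 he2)
  have h₁ : ((-Real.logb ν e : ℝ) : EReal) ≤ boundaryProduct ξ η := by
    rw [← visualKernel_le_iff hν, hrep e he0]; exact (le_max_left _ _).trans he1.le
  have h₂ : ((-Real.logb ν e : ℝ) : EReal) ≤ boundaryProduct η ζ := by
    rw [← visualKernel_le_iff hν, hrep e he0]; exact (le_max_right _ _).trans he1.le
  have h₃ := le_boundaryProduct hX ((EReal.coe_lt_coe_iff.2 hlt).trans_le h₁)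
    ((EReal.coe_lt_coe_iff.2 hlt).trans_le h₂)
  rw [← visualKernel_le_iff hν] at h₃
  refine h₃.trans ?_
  rw [show -(-Real.logb ν (c / 2) - δ) = Real.logb ν (c / 2) + δ by ring, Real.rpow_add hpos,
    Real.rpow_logb hpos hν.ne' (by linarith)]
  nlinarith

end Helpers

/-! ### Frink's metrization lemma -/

section Frink

variable {Z : Type*} (d : Z → Z → ℝ≥0)

theorem frink_chain (d_self : ∀ x, d x x = 0)
    (hd : ∀ x y z, d x z ≤ 2 * max (d x y) (d y z)) (c : ℕ → Z) :
    ∀ n m : ℕ, (d (c m) (c (m + (n + 2))) : ℝ) + 2 * d (c m) (c (m + 1))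
      + 2 * d (c (m + (n + 1))) (c (m + (n + 2)))
      ≤ 4 * ∑ i ∈ Finset.range (n + 2), (d (c (m + i)) (c (m + i + 1)) : ℝ) := by
  intro n
  induction n using Nat.strong_induction_on with
  | _ n ih =>
  intro m
  have hS : ∑ i ∈ Finset.range (n + 2), (d (c (m + i)) (c (m + i + 1)) : ℝ) =
      d (c m) (c (m + 1)) + (∑ i ∈ Finset.range n, (d (c (m + (i + 1))) (c (m + (i + 1) + 1)) : ℝ))
      + d (c (m + (n + 1))) (c (m + (n + 2))) := by
    rw [Finset.sum_range_succ, Finset.sum_range_succ']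
    simp only [add_zero, add_assoc]
    norm_num
    ring
  have hmid : (0 : ℝ) ≤
      ∑ i ∈ Finset.range n, (d (c (m + (i + 1))) (c (m + (i + 1) + 1)) : ℝ) := by positivity
  have hf0 : (0 : ℝ) ≤ d (c m) (c (m + 1)) := NNReal.coe_nonneg _
  have hl0 : (0 : ℝ) ≤ d (c (m + (n + 1))) (c (m + (n + 2))) := NNReal.coe_nonneg _
  have hd' : ∀ k, (d (c m) (c (m + (n + 2))) : ℝ) ≤ 2 * d (c m) (c (m + k)) ∨
      (d (c m) (c (m + (n + 2))) : ℝ) ≤ 2 * d (c (m + k)) (c (m + (n + 2))) := by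
    intro k
    have h := hd (c m) (c (m + k)) (c (m + (n + 2)))
    rcases le_total (d (c m) (c (m + k))) (d (c (m + k)) (c (m + (n + 2)))) with h' | h'
    · right; rw [max_eq_right h'] at h; exact_mod_cast h
    · left; rw [max_eq_left h'] at h; exact_mod_cast h
  by_cases hex : ∃ k < n + 2,
      (d (c m) (c (m + (n + 2))) : ℝ) ≤ 2 * d (c (m + k)) (c (m + (n + 2))) ∧
      (d (c m) (c (m + (n + 2))) : ℝ) ≤ 2 * d (c m) (c (m + (k + 1)))
  · obtain ⟨k, hk, h1, h2⟩ := hex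
    rcases Nat.eq_zero_or_pos k with rfl | hk0
    · rw [hS]; simp only [zero_add] at h2; linarith
    rcases Nat.lt_or_ge n k with hkn | hkn
    · obtain rfl : k = n + 1 := by omega
      rw [hS]; linarith
    obtain ⟨a, rfl⟩ : ∃ a, k = a + 1 := ⟨k - 1, by omega⟩
    obtain ⟨b, rfl⟩ : ∃ b, n = a + 1 + b := ⟨n - (a + 1), by omega⟩
    have ha := ih a (by omega) m
    have hb := ih b (by omega) (m + (a + 1))
    rw [show m + (a + 1) + (b + 2) = m + (a + 1 + b + 2) by ring,
      show m + (a + 1) + (b + 1) = m + (a + 1 + b + 1) by ring,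
      Finset.sum_range_succ'] at hb
    have hT : ∑ i ∈ Finset.range (a + 1 + b + 2), (d (c (m + i)) (c (m + i + 1)) : ℝ) =
        ∑ i ∈ Finset.range (a + 2), (d (c (m + i)) (c (m + i + 1)) : ℝ) +
        ∑ i ∈ Finset.range (b + 1),
          (d (c (m + (a + 1) + (i + 1))) (c (m + (a + 1) + (i + 1) + 1)) : ℝ) := by
      rw [show a + 1 + b + 2 = (a + 2) + (b + 1) by ring, Finset.sum_range_add]
      refine congrArg₂ _ rfl (Finset.sum_congr rfl fun i _ => ?_)
      rw [show m + (a + 2 + i) = m + (a + 1) + (i + 1) by ring]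
    rw [hT]
    simp only [add_zero] at hb
    rw [show m + (a + 1) + 1 = m + (a + 2) by ring] at hb
    rw [show a + 1 + 1 = a + 2 by ring] at h2
    linarith
  · have key : ∀ k ≤ n + 2,
        (d (c m) (c (m + (n + 2))) : ℝ) ≤ 2 * d (c (m + k)) (c (m + (n + 2))) := by
      intro k
      induction k with
      | zero =>
        intro _
        have : (0 : ℝ) ≤ d (c m) (c (m + (n + 2))) := NNReal.coe_nonneg _
        simp only [add_zero]; linarith
      | succ k ihk =>
        intro hk
        rcases hd' (k + 1) with h | h
        · exact absurd ⟨k, by omega, ihk (by omega), h⟩ hex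
        · exact h
    have h := key (n + 2) le_rfl
    rw [d_self] at h
    rw [hS]
    simp only [NNReal.coe_zero, mul_zero] at h
    linarith

theorem sum_zipWith_eq (x y z : Z) (l : List Z) :
    ((x :: l).zipWith d (l ++ [y])).sum =
      ∑ i ∈ Finset.range (l.length + 1),
        d ((x :: (l ++ [y])).getD i z) ((x :: (l ++ [y])).getD (i + 1) z) := by
  induction l generalizing x with
  | nil => simp
  | cons a l ih =>
    rw [List.length_cons, Finset.sum_range_succ']
    have := ih a
    simp only [List.cons_append, List.zipWith_cons_cons, List.sum_cons, List.getD_cons_succ,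
      List.getD_cons_zero] at this ⊢
    rw [this, add_comm]

/-- A symmetric kernel with `d x z ≤ 2 * max (d x y) (d y z)` is at most four times the pseudometric
obtained from it by the chain construction. -/
theorem frink (d_self : ∀ x, d x x = 0) (d_comm : ∀ x y, d x y = d y x)
    (hd : ∀ x y z, d x z ≤ 2 * max (d x y) (d y z)) (x y : Z) :
    (d x y : ℝ) ≤ 4 * @dist Z
      (@PseudoMetricSpace.toDist Z (PseudoMetricSpace.ofPreNNDist d d_self d_comm)) x y := by
  rw [PseudoMetricSpace.dist_ofPreNNDist, show (4 : ℝ) = ((4 : ℝ≥0) : ℝ) by norm_num,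
    ← NNReal.coe_mul, NNReal.mul_iInf, NNReal.coe_le_coe]
  refine le_ciInf fun l => ?_
  rw [sum_zipWith_eq d x y x l, ← NNReal.coe_le_coe]
  push_cast
  rcases l with _ | ⟨a, l⟩
  · have : (0 : ℝ) ≤ d x y := NNReal.coe_nonneg _
    simp; linarith
  · set c : ℕ → Z := fun i => (x :: (a :: l ++ [y])).getD i x with hc
    have h := frink_chain d d_self hd c l.length 0
    simp only [zero_add] at h
    have h0 : c 0 = x := by simp [hc]
    have h1 : c (l.length + 2) = y := by simp [hc, List.getD]
    rw [h0, h1] at h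
    have hf0 : (0 : ℝ) ≤ d x (c 1) := NNReal.coe_nonneg _
    have hl0 : (0 : ℝ) ≤ d (c (l.length + 1)) y := NNReal.coe_nonneg _
    simp only [List.length_cons]
    exact le_trans (by linarith) h

end Frink

/-- The visual metric of parameter `ν` on the Gromov boundary of a `δ`-hyperbolic pointed space:
the metric that the chain construction
`inf {∑ ν ^ (-(ξ_{i-1} ∣ ξ_i)_o) : ξ = ξ_0, …, ξ_n = ξ', n ≥ 1}` produces from the visual kernel.
By Frink's lemma it is a metric if `ν ^ δ ≤ 2`, that is, if `ν ≤ 2 ^ (1 / δ)` when `0 < δ`. -/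
@[reducible]
def visualMetric {X : Type w} [MetricSpace X] (o : X) {δ ν : ℝ} (hX : IsHyperbolic δ X)
    (hν : 1 < ν) (hνδ : ν ^ δ ≤ 2) : MetricSpace (GromovBoundary o) :=
  { PseudoMetricSpace.ofPreNNDist (visualKernel (o := o) ν) (visualKernel_self hX)
      visualKernel_comm with
    eq_of_dist_eq_zero := by
      intro ξ η h
      have h' := frink (visualKernel (o := o) ν) (visualKernel_self hX) visualKernel_comm
        (visualKernel_quasi hX hν hνδ) ξ η
      refine eq_of_visualKernel_eq_zero hν (le_antisymm ?_ (zero_le))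
      rw [← NNReal.coe_le_coe]
      refine h'.trans (le_of_eq ?_)
      rw [NNReal.coe_zero, mul_eq_zero]
      exact Or.inr h }

/-- `φ` is the boundary map induced by `f`: for each Cauchy-Gromov sequence `x`, the sequence
`f ∘ x` is Cauchy-Gromov, and it represents the image by `φ` of the point that `x` represents. -/
def InducesBoundaryMap {X Y : Type*} [MetricSpace X] [MetricSpace Y] {o : X} {p : Y} (f : X → Y)
    (φ : GromovBoundary o → GromovBoundary p) : Prop :=
  ∀ x : CauchyGromovSeq o, ∃ h : IsCauchyGromov p (f ∘ x.1),
    φ (GromovBoundary.mk x) = GromovBoundary.mk ⟨f ∘ x.1, h⟩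

/-! ### Cross-ratios and sublinearly quasiMöbius homeomorphisms -/

/-- The metric cross-ratio `[ξ₁, ξ₂, ξ₃, ξ₄]`; the indices run from `0` to `3` here. -/
def crossRatio {Z : Type*} [MetricSpace Z] (ξ : Fin 4 → Z) : ℝ :=
  (dist (ξ 0) (ξ 2) * dist (ξ 1) (ξ 3)) / (dist (ξ 0) (ξ 3) * dist (ξ 1) (ξ 2))

/-- The positive part of the logarithm in base `ν`. -/
def logPlus (ν s : ℝ) : ℝ :=
  max 0 (Real.logb ν s)

/-- The supremum over `i ≠ j` of a function of two of four indices. -/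
def supPairs (F : Fin 4 → Fin 4 → ℝ) : ℝ :=
  sSup {r | ∃ i j, i ≠ j ∧ r = F i j}

/-- `(aLow, aUp, O(u))`-sublinearly quasiMöbius homeomorphisms. -/
def IsSublinearlyQuasiMobius {Z W : Type*} [MetricSpace Z] [MetricSpace W]
    (aLow aUp : ℝ) (u : ℝ → ℝ) (φ : Z ≃ₜ W) : Prop :=
  ∃ v : ℝ → ℝ, v =O[atTop] u ∧ ∃ ν : ℝ, 1 < ν ∧ ∃ E : ℝ, 0 < E ∧
    ∀ ξ : Fin 4 → Z, (∀ i j, i ≠ j → 0 < dist (ξ i) (ξ j) ∧ dist (ξ i) (ξ j) < E) →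
      aLow * logPlus ν (crossRatio ξ) - v (supPairs fun i j => -Real.logb ν (dist (ξ i) (ξ j)))
        ≤ logPlus ν (crossRatio (φ ∘ ξ)) ∧
      logPlus ν (crossRatio (φ ∘ ξ))
        ≤ aUp * logPlus ν (crossRatio ξ)
          + v (supPairs fun i j => -Real.logb ν (dist (ξ i) (ξ j)))

end SublinearMobius

end

/-! On the ball of radius `R` about the base point, a sublinearly biLipschitz map is a
quasi-isometric embedding with additive constant `O(u R)`. The proof therefore needs a Morse lemma
that is linear in the additive constant (`exists_near_quasigeodesic`). It comes from iterating the
four-point inequality dyadically (`IsHyperbolic.chain`): a detour of `N` steps costs `O(δ log N)`,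
`N` is at most linear in the size of the detour, and a logarithm is absorbed by a small multiple of
that size.

On a ball, `f` thus keeps small Gromov products at `x` of size `O(u R)`. To replace `R` by `|x|`,
one uses sublinearity: beyond the scale `|x|`, the image of a geodesic leaving `x` makes linear
progress away from `f x`, so distant parts of the geodesic cannot affect the product at `f x`
(`exists_gromovProduct_le`). Applied at the center of a triangle, this shows that `f` changes `(x ∣
y)_z` by factors `lam` and `lam'`, up to `O(u(|z| + (x ∣ y)_z))` (`exists_gromovProduct_estimates`).

At the base point the error is absorbed, so products are distorted at most linearly in both
directions; hence `f` induces a boundary bijection that is Hölder both ways. For cross-ratios,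
estimating four products at the base point would fail: they occur with both signs, and `lam` and
`lam'` differ. But the cross-difference does not depend on the base point. Seen from the center `m`
of three of the points, its positive part is a single Gromov product up to `O(δ)`, and `|m|` is
controlled by the products at `o` (`exists_crossDifference_estimates`). Frink's lemma turns products
into logarithms of visual distances up to `logb ν 4`. -/

noncomputable section

namespace SublinearMobius

/-! ### Admissible functions -/

namespace Admissible

variable {u : ℝ → ℝ}

theorem exists_two_mul_le (hu : Admissible u) : ∃ D, 1 ≤ D ∧ ∀ r, 0 ≤ r → u (2 * r) ≤ D * u r := by
  obtain ⟨c, hc⟩ := hu.doubling.bound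
  obtain ⟨R, hR⟩ := eventually_atTop.1 hc
  have hR0 : 0 ≤ max R 0 := le_max_right _ _
  have h1 := hu.one_le (2 * max R 0) (by linarith)
  refine ⟨max c (u (2 * max R 0)), h1.trans (le_max_right _ _), fun r hr => ?_⟩
  have hur := hu.one_le r hr
  rcases le_total R r with h | h
  · have := hR r h
    rw [Real.norm_of_nonneg (by linarith [hu.one_le (2 * r) (by linarith)]),
      Real.norm_of_nonneg (by linarith)] at this
    exact this.trans (mul_le_mul_of_nonneg_right (le_max_left _ _) (by linarith))
  · have : u (2 * r) ≤ u (2 * max R 0) := hu.mono (mem_Ici.2 (by linarith))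
      (mem_Ici.2 (by linarith)) (by linarith [le_max_left R 0])
    have h2 := le_max_right c (u (2 * max R 0))
    nlinarith

theorem exists_two_pow_mul_le (hu : Admissible u) (n : ℕ) :
    ∃ D, 1 ≤ D ∧ ∀ r, 0 ≤ r → u (2 ^ n * r) ≤ D * u r := by
  obtain ⟨D, hD, h⟩ := hu.exists_two_mul_le
  induction n with
  | zero => exact ⟨1, le_rfl, fun r _ => by simp⟩
  | succ n ih =>
    obtain ⟨D', hD', h'⟩ := ih
    refine ⟨D * D', by nlinarith, fun r hr => ?_⟩
    rw [pow_succ', mul_assoc, mul_assoc]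
    exact (h _ (by positivity)).trans (mul_le_mul_of_nonneg_left (h' r hr) (by linarith))

/-- Doubling makes `u` insensitive to affine changes of scale. Error terms at different radii are
brought back to one radius in this way. -/
theorem exists_le_mul (hu : Admissible u) (a b : ℝ) :
    ∃ D, 1 ≤ D ∧ ∀ r s, 0 ≤ r → 0 ≤ s → s ≤ a * r + b → u s ≤ D * u r := by
  obtain ⟨n, hn⟩ := pow_unbounded_of_one_lt (|a| + |b|) (one_lt_two)
  obtain ⟨D, hD, h⟩ := hu.exists_two_pow_mul_le n
  have h1 := hu.one_le 1 zero_le_one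
  refine ⟨D * u 1, by nlinarith, fun r s hr hs hrs => ?_⟩
  have hm : (1 : ℝ) ≤ max r 1 := le_max_right _ _
  have hur := hu.one_le r hr
  have hle : s ≤ 2 ^ n * max r 1 := by
    have h1 : a * r ≤ |a| * max r 1 := by
      nlinarith [le_abs_self a, le_max_left r 1, abs_nonneg a]
    have h2 : b ≤ |b| * max r 1 := by nlinarith [le_abs_self b, abs_nonneg b]
    nlinarith
  have hmax : u (max r 1) ≤ u 1 * u r := by
    rcases max_choice r 1 with h | h <;> rw [h] <;> nlinarith
  calc u s ≤ u (2 ^ n * max r 1) := hu.mono hs (mem_Ici.2 (by positivity)) hle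
    _ ≤ D * u (max r 1) := h _ (by linarith)
    _ ≤ D * u 1 * u r := by rw [mul_assoc]; exact mul_le_mul_of_nonneg_left hmax (by linarith)

theorem exists_le_mul_add (hu : Admissible u) {ε : ℝ} (hε : 0 < ε) :
    ∃ K, 0 ≤ K ∧ ∀ r, 0 ≤ r → u r ≤ ε * r + K := by
  obtain ⟨R, hR⟩ := eventually_atTop.1 (hu.sublinear.bound hε)
  have hR0 : 0 ≤ max R 0 := le_max_right _ _
  have h1 := hu.one_le _ hR0
  refine ⟨u (max R 0), by linarith, fun r hr => ?_⟩
  have hur := hu.one_le r hr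
  rcases le_total R r with h | h
  · have := hR r h
    rw [Real.norm_of_nonneg (by linarith), Real.norm_of_nonneg hr] at this
    linarith
  · have := hu.mono hr hR0 (h.trans (le_max_left R 0))
    have := mul_nonneg hε.le hr
    linarith

/-- On the bounded interval where the asymptotic bound says nothing, monotonicity bounds `v` by a
constant, and `u ≥ 1` absorbs that constant. -/
theorem exists_bound_of_isBigO (hu : Admissible u) {v : ℝ → ℝ} (hv : MonotoneOn v (Ici 0))
    (h : v =O[atTop] u) : ∃ C, 1 ≤ C ∧ ∀ r, 0 ≤ r → v r ≤ C * u r := by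
  obtain ⟨c, hc⟩ := h.bound
  obtain ⟨R, hR⟩ := eventually_atTop.1 hc
  have hR0 : 0 ≤ max R 0 := le_max_right _ _
  refine ⟨max (max c (v (max R 0))) 1, le_max_right _ _, fun r hr => ?_⟩
  have hur := hu.one_le r hr
  have hc1 := (le_max_left c (v (max R 0))).trans (le_max_left _ 1)
  have hc2 := (le_max_right c (v (max R 0))).trans (le_max_left _ 1)
  have hc3 := le_max_right (max c (v (max R 0))) 1
  rcases le_total R r with h | h
  · have := hR r h
    rw [Real.norm_of_nonneg (r := u r) (by linarith)] at this
    exact (le_abs_self _).trans (this.trans (mul_le_mul_of_nonneg_right hc1 (by linarith)))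
  · have := hv hr hR0 (h.trans (le_max_left R 0))
    nlinarith

end Admissible

/-! ### Gromov products -/

section GromovProduct

variable {X : Type*} [MetricSpace X] {δ : ℝ}

theorem IsHyperbolic.nonneg (hX : IsHyperbolic δ X) (o : X) : 0 ≤ δ := by
  have := hX o o o o
  simp [gromovProduct] at this
  exact this

theorem IsHyperbolic.le_or_le (hX : IsHyperbolic δ X) {p x y z : X} {a : ℝ}
    (h : gromovProduct p x z ≤ a) :
    gromovProduct p x y ≤ a + δ ∨ gromovProduct p y z ≤ a + δ := by
  have := hX p x y z
  rcases min_choice (gromovProduct p x y) (gromovProduct p y z) with h' | h' <;> rw [h'] at this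
  · left; linarith
  · right; linarith

theorem IsHyperbolic.le_of_le (hX : IsHyperbolic δ X) {p x y z : X} {a : ℝ}
    (h : a ≤ gromovProduct p x y) (h' : a ≤ gromovProduct p y z) :
    a - δ ≤ gromovProduct p x z := by
  have := hX p x y z
  have := le_min h h'
  linarith

theorem gromovProduct_le_dist (p x y : X) : gromovProduct p x y ≤ dist p x := by
  have := dist_triangle y x p
  rw [dist_comm y x] at this
  rw [dist_comm p x]
  unfold gromovProduct; linarith

theorem dist_sub_le_gromovProduct (p x y : X) : dist p x - dist x y ≤ gromovProduct p x y := by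
  have := dist_triangle x y p
  rw [dist_comm p x]
  unfold gromovProduct; linarith

theorem gromovProduct_le_add_dist (p q x y : X) :
    gromovProduct p x y ≤ gromovProduct q x y + dist p q := by
  have := dist_triangle x q p
  have := dist_triangle y q p
  rw [dist_comm q p] at *
  unfold gromovProduct; linarith

theorem gromovProduct_add (x y z : X) :
    gromovProduct x y z + gromovProduct y x z = dist x y := by
  simp only [gromovProduct, dist_comm]; ring

/-- The double difference of Gromov products does not depend on the base point. -/
theorem gromovProduct_double_difference (p q a b c d : X) :
    gromovProduct p a d + gromovProduct p b c - gromovProduct p a c - gromovProduct p b d =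
      gromovProduct q a d + gromovProduct q b c - gromovProduct q a c - gromovProduct q b d := by
  simp only [gromovProduct]; ring

theorem IsGeodesicSpace.exists_between (hX : IsGeodesicSpace X) (x y : X) {r : ℝ} (hr : 0 ≤ r)
    (hr' : r ≤ dist x y) : ∃ w, dist x w = r ∧ dist w y = dist x y - r := by
  obtain ⟨c, h0, h1, hc⟩ := hX x y
  refine ⟨c r, ?_, ?_⟩
  · have := hc 0 ⟨le_rfl, dist_nonneg⟩ r ⟨hr, hr'⟩
    rw [h0] at this
    rw [this, zero_sub, abs_neg, abs_of_nonneg hr]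
  · have := hc r ⟨hr, hr'⟩ (dist x y) ⟨dist_nonneg, le_rfl⟩
    rw [h1] at this
    rw [this, abs_sub_comm, abs_of_nonneg (by linarith)]

theorem gromovProduct_mem_Icc (x y z : X) : gromovProduct y x z ∈ Icc 0 (dist y z) :=
  ⟨gromovProduct_nonneg _ _ _, by rw [gromovProduct_comm]; exact gromovProduct_le_dist _ _ _⟩

/-- A point of `[y, z]` that cuts off the Gromov product `(x ∣ z)_y` is close to all three sides of
the triangle. -/
theorem IsHyperbolic.center_estimates (hX : IsHyperbolic δ X) {x y z p : X}
    (h₁ : dist y p = gromovProduct y x z) (h₂ : dist p z = dist y z - gromovProduct y x z) :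
    dist x p ≤ gromovProduct x y z + 2 * δ ∧ gromovProduct p y z = 0 ∧
      gromovProduct p x y ≤ δ ∧ gromovProduct p x z ≤ δ := by
  -- Both `(y ∣ x)_p` and `(x ∣ z)_p` equal half of `dist x p - (y ∣ z)_x`, while `(y ∣ z)_p = 0`.
  -- The four-point inequality through `x` bounds their common value by `δ`.
  have h := hX p y x z
  have h3 : gromovProduct p y z = 0 := by
    unfold gromovProduct; rw [dist_comm z p, h₁, h₂]; ring
  have h4 : gromovProduct p y x = (dist x p - gromovProduct x y z) / 2 := by
    unfold gromovProduct at *; rw [h₁, dist_comm y x, dist_comm z x, dist_comm z y]; ring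
  have h5 : gromovProduct p x z = (dist x p - gromovProduct x y z) / 2 := by
    unfold gromovProduct at *; rw [dist_comm z p, h₂, dist_comm y x, dist_comm z x, dist_comm z y]
    ring
  rw [h3, h4, h5, min_self] at h
  refine ⟨by linarith, h3, ?_, ?_⟩
  · rw [gromovProduct_comm, h4]; linarith
  · rw [h5]; linarith

theorem IsGeodesicSpace.exists_center (hX : IsHyperbolic δ X) (hg : IsGeodesicSpace X) (x y z : X) :
    ∃ p, dist x p ≤ gromovProduct x y z + 2 * δ ∧ gromovProduct p y z = 0 ∧
      gromovProduct p x y ≤ δ ∧ gromovProduct p x z ≤ δ := by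
  obtain ⟨h0, h1⟩ := gromovProduct_mem_Icc x y z
  obtain ⟨p, hp, hp'⟩ := hg.exists_between y z h0 h1
  exact ⟨p, hX.center_estimates hp hp'⟩

/-- Splitting the chain at a power of two costs one `δ` per level, so the loss is logarithmic in
`N`. -/
theorem IsHyperbolic.chain (hX : IsHyperbolic δ X) (p : X) {B : ℝ} (n : ℕ) :
    ∀ (x : ℕ → X) (N : ℕ), 1 ≤ N → N ≤ 2 ^ n →
      (∀ i < N, B ≤ gromovProduct p (x i) (x (i + 1))) →
      B - n * δ ≤ gromovProduct p (x 0) (x N) := by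
  have hδ := hX.nonneg p
  induction n with
  | zero =>
    intro x N h1 h2 h
    obtain rfl : N = 1 := by simp at h2; omega
    simpa using h 0 one_pos
  | succ n ih =>
    intro x N h1 h2 h
    push_cast
    rcases le_or_gt N (2 ^ n) with hN | hN
    · linarith [ih x N h1 hN h]
    · obtain ⟨k, rfl⟩ := Nat.exists_eq_add_of_lt hN
      have ha := ih x (2 ^ n) Nat.one_le_two_pow le_rfl fun i hi => h i (by omega)
      have hb := ih (fun i => x (2 ^ n + i)) (k + 1) (by omega) (by rw [pow_succ] at h2; omega)
        fun i hi => h (2 ^ n + i) (by omega)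
      have := hX.le_of_le ha hb
      rw [show 2 ^ n + k + 1 = 2 ^ n + (k + 1) by ring]
      linarith

end GromovProduct

/-! ### Stability of quasigeodesics, linear in the additive constant -/

theorem exists_le_two_pow {ε : ℝ} (hε : 0 < ε) :
    ∃ C, 0 ≤ C ∧ ∀ N : ℕ, ∃ n : ℕ, N ≤ 2 ^ n ∧ (n : ℝ) ≤ ε * N + C := by
  have h2 : 0 < Real.log 2 := Real.log_pos one_lt_two
  set η := ε * Real.log 2 with hη
  have hη0 : 0 < η := mul_pos hε h2
  refine ⟨|Real.log η| / Real.log 2 + 1, by positivity, fun N => ?_⟩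
  refine ⟨Nat.log 2 N + 1, (Nat.lt_pow_succ_log_self one_lt_two N).le, ?_⟩
  have h1 : (Nat.log 2 N : ℝ) ≤ Real.log N / Real.log 2 := Real.natLog_le_logb N 2
  have h3 : Real.log N ≤ η * N + |Real.log η| := by
    rcases Nat.eq_zero_or_pos N with rfl | hN
    · simp
    · have hN' : (0 : ℝ) < N := by exact_mod_cast hN
      have := Real.log_le_sub_one_of_pos (mul_pos hη0 hN')
      rw [Real.log_mul hη0.ne' hN'.ne'] at this
      linarith [neg_abs_le (Real.log η)]
  have h4 : Real.log N / Real.log 2 ≤ ε * N + |Real.log η| / Real.log 2 := by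
    rw [div_le_iff₀ h2, add_mul, div_mul_cancel₀ _ h2.ne']
    calc _ ≤ _ := h3
      _ = _ := by rw [hη]; ring
  push_cast
  linarith

section Morse

variable {Y : Type*} [MetricSpace Y] {δ : ℝ}

/-- `σ` is a geodesic parametrized by arc length on `[0, ℓ]`. -/
def IsGeodesicOn (ℓ : ℝ) (σ : ℝ → Y) : Prop :=
  ∀ s ∈ Icc 0 ℓ, ∀ t ∈ Icc 0 ℓ, dist (σ s) (σ t) = |s - t|

/-- `g` is a quasigeodesic on `[0, L]`. -/
structure IsQuasigeodesicOn (lam lam' K L : ℝ) (g : ℝ → Y) : Prop where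
  upper : ∀ s ∈ Icc 0 L, ∀ t ∈ Icc 0 L, dist (g s) (g t) ≤ lam' * |s - t| + K
  lower : ∀ s ∈ Icc 0 L, ∀ t ∈ Icc 0 L, lam * |s - t| - K ≤ dist (g s) (g t)

theorem IsGeodesicOn.gromovProduct_eq_zero {ℓ : ℝ} {σ : ℝ → Y} (h : IsGeodesicOn ℓ σ)
    {r s t : ℝ} (hr : 0 ≤ r) (hrs : r ≤ s) (hst : s ≤ t) (ht : t ≤ ℓ) :
    gromovProduct (σ s) (σ r) (σ t) = 0 := by
  have hr' : r ∈ Icc 0 ℓ := ⟨hr, by linarith⟩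
  have hs' : s ∈ Icc 0 ℓ := ⟨by linarith, by linarith⟩
  have ht' : t ∈ Icc 0 ℓ := ⟨by linarith, ht⟩
  rw [gromovProduct, h r hr' s hs', h t ht' s hs', h r hr' t ht', abs_of_nonpos (by linarith),
    abs_of_nonneg (by linarith), abs_of_nonpos (by linarith)]
  ring

/-- Cut `[s, t]` into `N` pieces of length at most `1`. Each jump of `g` is at most `lam' + K` and
starts at distance at least `D` from `p`, so consecutive products are at least `D - (lam' + K)`. No
continuity of `g` is involved. -/
theorem IsQuasigeodesicOn.chain (hY : IsHyperbolic δ Y) {lam lam' K L : ℝ} (hlam' : 0 ≤ lam')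
    {g : ℝ → Y} (hg : IsQuasigeodesicOn lam lam' K L g) {s t : ℝ} (hs : s ∈ Icc 0 L)
    (ht : t ∈ Icc 0 L) {p : Y} {D : ℝ} (hD : ∀ r ∈ Icc 0 L, D ≤ dist p (g r)) {N n : ℕ}
    (hN : 1 ≤ N) (hstN : |s - t| ≤ N) (hNn : N ≤ 2 ^ n) :
    D - (lam' + K) - n * δ ≤ gromovProduct p (g s) (g t) := by
  have hN0 : (0 : ℝ) < N := by exact_mod_cast hN
  set τ : ℕ → ℝ := fun i => s + (t - s) * (i / N) with hτ
  have hmem : ∀ i ≤ N, τ i ∈ Icc 0 L := by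
    intro i hi
    have h0 : (0 : ℝ) ≤ i / N := by positivity
    have h1 : (i : ℝ) / N ≤ 1 := by
      rw [div_le_one hN0]; exact_mod_cast hi
    have h2 : τ i = (1 - (i / N : ℝ)) * s + (i / N : ℝ) * t := by simp only [hτ]; ring
    rw [h2]
    exact convex_Icc 0 L hs ht (by linarith) h0 (by ring)
  have h := hY.chain p (B := D - (lam' + K)) n (fun i => g (τ i)) N hN hNn fun i hi => by
    have h1 := hD _ (hmem i hi.le)
    have h2 := hg.upper _ (hmem i hi.le) _ (hmem (i + 1) hi)
    have h3 := dist_sub_le_gromovProduct p (g (τ i)) (g (τ (i + 1)))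
    have h4 : |τ i - τ (i + 1)| ≤ 1 := by
      have : τ i - τ (i + 1) = (s - t) / N := by simp only [hτ]; push_cast; ring
      rw [this, abs_div, abs_of_pos hN0, div_le_one hN0]
      exact hstN
    nlinarith
  simpa [hτ, hN0.ne'] using h

/-- At a point `p` of the geodesic almost as far as possible (about `D`) from the quasigeodesic,
leave the geodesic about `2 D` before and after `p` and join the exits through `g`. This path avoids
the ball of radius `D - 1` about `p`, so up to a logarithmic loss its endpoints have product about
`D` at `p`; yet they lie on a geodesic through `p`, where the product is `0`. That `H` does not
depend on `K` is essential later. -/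
theorem exists_near_quasigeodesic (hY : IsHyperbolic δ Y) {lam lam' : ℝ} (hlam : 0 < lam)
    (hlam' : 0 < lam') : ∃ H, 0 ≤ H ∧ ∀ (K L ℓ : ℝ) (g σ : ℝ → Y), 1 ≤ K → 0 ≤ L → 0 ≤ ℓ →
      IsQuasigeodesicOn lam lam' K L g → IsGeodesicOn ℓ σ → σ 0 = g 0 → σ ℓ = g L →
      ∀ s ∈ Icc 0 ℓ, ∃ t ∈ Icc 0 L, dist (σ s) (g t) ≤ H * K := by
  rcases isEmpty_or_nonempty Y with hemp | ⟨⟨y₀⟩⟩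
  · exact ⟨0, le_rfl, fun _ _ _ g => (hemp.false (g 0)).elim⟩
  have hδ := hY.nonneg y₀
  -- With this slope, `δ * n` is at most `D / 2` plus terms not involving `D`, because `lam * N` is
  -- at most `6 * D` plus such terms.
  set ε := lam / (12 * (δ + 1)) with hε
  have hε0 : 0 < ε := by positivity
  obtain ⟨C, hC0, hC⟩ := exists_le_two_pow hε0
  refine ⟨2 * (3 + lam' + lam / 4 + δ * (C + 2)) + 1, by positivity, ?_⟩
  intro K L ℓ g σ hK hL hℓ hg hσ h0 h1 s₀ hs₀
  set S : Set Y := g '' Icc 0 L with hS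
  have hSne : S.Nonempty := ⟨g 0, 0, ⟨le_rfl, hL⟩, rfl⟩
  set h : ℝ → ℝ := fun s => Metric.infDist (σ s) S with hh
  have hbdd : BddAbove (h '' Icc 0 ℓ) := by
    refine ⟨ℓ, ?_⟩
    rintro _ ⟨s, hs, rfl⟩
    refine (Metric.infDist_le_dist_of_mem (y := g 0) (mem_image_of_mem g (left_mem_Icc.2 hL))).trans ?_
    rw [← h0, hσ s hs 0 ⟨le_rfl, hℓ⟩, sub_zero, abs_of_nonneg hs.1]
    exact hs.2
  set D := sSup (h '' Icc 0 ℓ) with hDdef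
  have hle : ∀ s ∈ Icc 0 ℓ, h s ≤ D := fun s hs => le_csSup hbdd ⟨s, hs, rfl⟩
  have hD0 : 0 ≤ D := Metric.infDist_nonneg.trans (hle s₀ hs₀)
  have hnear : ∀ s ∈ Icc 0 ℓ, ∃ t ∈ Icc 0 L, dist (σ s) (g t) < D + 1 := by
    intro s hs
    obtain ⟨_, ⟨t, ht, rfl⟩, h'⟩ := (Metric.infDist_lt_iff hSne).1
      ((hle s hs).trans_lt (lt_add_one D))
    exact ⟨t, ht, h'⟩
  suffices hD : D ≤ 2 * (3 + lam' + lam / 4 + δ * (C + 2)) * K by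
    obtain ⟨t, ht, h'⟩ := hnear s₀ hs₀
    exact ⟨t, ht, by linarith⟩
  obtain ⟨_, ⟨s, hs, rfl⟩, hsD⟩ := exists_lt_of_lt_csSup
    (⟨_, s₀, hs₀, rfl⟩ : (h '' Icc 0 ℓ).Nonempty) (sub_one_lt D)
  set p := σ s with hp
  have hfar : ∀ r ∈ Icc 0 L, D - 1 ≤ dist p (g r) := fun r hr =>
    hsD.le.trans (Metric.infDist_le_dist_of_mem ⟨r, hr, rfl⟩)
  -- At distance `2 * D` from `p`, a jump of length at most `D + 1` to `g` keeps the product at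
  -- least `D - 1`. If the geodesic ends earlier, its endpoint already lies on `g`.
  obtain ⟨s₁, t₁, hs₁, ht₁, hs₁s, hd₁, hd₁', hp₁⟩ : ∃ s₁ t₁, 0 ≤ s₁ ∧ t₁ ∈ Icc 0 L ∧ s₁ ≤ s ∧
      s - s₁ ≤ 2 * D ∧ dist (σ s₁) (g t₁) ≤ D + 1 ∧ D - 1 ≤ gromovProduct p (σ s₁) (g t₁) := by
    rcases le_total s (2 * D) with h | h
    · refine ⟨0, 0, le_rfl, ⟨le_rfl, hL⟩, hs.1, by linarith, by rw [h0, dist_self]; linarith, ?_⟩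
      have := dist_sub_le_gromovProduct p (σ 0) (g 0)
      have h2 := hfar 0 ⟨le_rfl, hL⟩
      rw [h0, dist_self] at *; linarith
    · have hm : s - 2 * D ∈ Icc 0 ℓ := ⟨by linarith, by linarith [hs.2]⟩
      obtain ⟨t, ht, h'⟩ := hnear _ hm
      refine ⟨s - 2 * D, t, hm.1, ht, by linarith, by linarith, h'.le, ?_⟩
      have h2 := dist_sub_le_gromovProduct p (σ (s - 2 * D)) (g t)
      rw [hp, hσ s hs _ hm, abs_of_nonneg (by linarith)] at h2
      linarith
  obtain ⟨s₂, t₂, hs₂, ht₂, hs₂s, hd₂, hd₂', hp₂⟩ : ∃ s₂ t₂, s₂ ≤ ℓ ∧ t₂ ∈ Icc 0 L ∧ s ≤ s₂ ∧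
      s₂ - s ≤ 2 * D ∧ dist (σ s₂) (g t₂) ≤ D + 1 ∧ D - 1 ≤ gromovProduct p (σ s₂) (g t₂) := by
    rcases le_total (ℓ - s) (2 * D) with h | h
    · refine ⟨ℓ, L, le_rfl, ⟨hL, le_rfl⟩, hs.2, by linarith, by rw [h1, dist_self]; linarith, ?_⟩
      have := dist_sub_le_gromovProduct p (σ ℓ) (g L)
      have h2 := hfar L ⟨hL, le_rfl⟩
      rw [h1, dist_self] at *; linarith
    · have hm : s + 2 * D ∈ Icc 0 ℓ := ⟨by linarith [hs.1], by linarith⟩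
      obtain ⟨t, ht, h'⟩ := hnear _ hm
      refine ⟨s + 2 * D, t, hm.2, ht, by linarith, by linarith, h'.le, ?_⟩
      have h2 := dist_sub_le_gromovProduct p (σ (s + 2 * D)) (g t)
      rw [hp, hσ s hs _ hm, abs_of_nonpos (by linarith)] at h2
      linarith
  obtain ⟨n, hNn, hn⟩ := hC (⌈|t₁ - t₂|⌉₊ + 1)
  set N := ⌈|t₁ - t₂|⌉₊ + 1 with hN
  have hNle : (N : ℝ) ≤ |t₁ - t₂| + 2 := by
    rw [hN]; push_cast; linarith [Nat.ceil_lt_add_one (abs_nonneg (t₁ - t₂))]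
  have hchain := hg.chain hY hlam'.le ht₁ ht₂ hfar (N := N) (by omega)
    ((Nat.le_ceil _).trans (by rw [hN]; push_cast; linarith)) hNn
  have hzero := hσ.gromovProduct_eq_zero hs₁ hs₁s hs₂s hs₂
  rw [← hp] at hzero
  have hn0 : 0 ≤ (n : ℝ) * δ := by positivity
  rw [gromovProduct_comm] at hp₂
  have e1 := hY.le_of_le (a := D - 1 - (lam' + K) - n * δ) hchain (by linarith)
  have e2 := hY.le_of_le (a := D - 1 - (lam' + K) - n * δ - δ) (x := σ s₁) (by linarith) e1
  rw [hzero] at e2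
  have hlow := hg.lower _ ht₁ _ ht₂
  have htri : dist (g t₁) (g t₂) ≤ 2 * (D + 1) + 4 * D := by
    have a1 := dist_triangle4 (g t₁) (σ s₁) (σ s₂) (g t₂)
    rw [hσ s₁ ⟨hs₁, by linarith⟩ s₂ ⟨by linarith, hs₂⟩, abs_of_nonpos (by linarith),
      dist_comm (g t₁) (σ s₁)] at a1
    linarith
  have hδε : δ * ε ≤ lam / 12 := by
    rw [hε, mul_div_assoc', div_le_div_iff₀ (by positivity) (by norm_num)]
    nlinarith
  have hNlam : lam * N ≤ 6 * D + 2 + K + 2 * lam := by nlinarith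
  have hδn : δ * n ≤ (6 * D + 2 + K + 2 * lam) / 12 + δ * C := by
    calc δ * n ≤ δ * (ε * N + C) := mul_le_mul_of_nonneg_left hn hδ
      _ = δ * ε * N + δ * C := by ring
      _ ≤ lam / 12 * N + δ * C := by gcongr
      _ ≤ _ := by linarith
  have hfin : D ≤ 2 * (1 + lam' + K + (2 + K) / 12 + lam / 6 + δ * (C + 2)) := by linarith
  have hX : 0 ≤ lam' + lam / 4 + δ * (C + 2) := by positivity
  nlinarith

/-- In the form needed here, the Morse lemma bounds Gromov products along a quasigeodesic. -/
theorem exists_gromovProduct_le_of_quasigeodesic (hY : IsHyperbolic δ Y) (hYg : IsGeodesicSpace Y)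
    {lam lam' : ℝ} (hlam : 0 < lam) (hlam' : 0 < lam') :
    ∃ H, 0 ≤ H ∧ ∀ (K L : ℝ) (g : ℝ → Y), 1 ≤ K → 0 ≤ L → IsQuasigeodesicOn lam lam' K L g →
      ∀ t ∈ Icc 0 L, gromovProduct (g t) (g 0) (g L) ≤ H * K := by
  obtain ⟨H, hH0, hH⟩ := exists_near_quasigeodesic hY hlam hlam'
  refine ⟨lam' * ((2 * H + 2) / lam) + 1 + H, by positivity, ?_⟩
  intro K L g hK hL hg t₀ ht₀
  obtain ⟨σ, hσ0, hσ1, hσ⟩ := hYg (g 0) (g L)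
  set ℓ := dist (g 0) (g L) with hℓ
  have hℓ0 : 0 ≤ ℓ := dist_nonneg
  have hσ' : IsGeodesicOn ℓ σ := hσ
  -- The lemma above places the geodesic near `g`; the converse is needed here. Integer points of
  -- `σ` are given nearby parameters `t`, with the endpoints prescribed. The clause `0 < i` avoids a
  -- conflict between them when `ℓ = 0`.
  have hex : ∀ i : ℕ, ∃ t ∈ Icc 0 L, dist (σ (min i ℓ)) (g t) ≤ H * K ∧ (i = 0 → t = 0) ∧
      (ℓ ≤ i → 0 < i → t = L) := by
    intro i
    rcases Nat.eq_zero_or_pos i with rfl | hi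
    · exact ⟨0, ⟨le_rfl, hL⟩, by simp [hℓ0, hσ0]; positivity, fun _ => rfl, by simp⟩
    rcases le_or_gt ℓ i with h | h
    · exact ⟨L, ⟨hL, le_rfl⟩, by rw [min_eq_right h, hσ1, dist_self]; positivity, by omega,
        fun _ _ => rfl⟩
    · obtain ⟨t, ht, h'⟩ := hH K L ℓ g σ hK hL hℓ0 hg hσ' hσ0 hσ1 (min i ℓ)
        ⟨by positivity, min_le_right _ _⟩
      exact ⟨t, ht, h', by omega, fun h'' => absurd h'' (not_le.2 h)⟩
  choose τ hτ hτd hτ0 hτL using hex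
  have hfind : ∃ i, t₀ ≤ τ i := by
    refine ⟨⌈ℓ⌉₊ + 1, ?_⟩
    rw [hτL _ (by push_cast; linarith [Nat.le_ceil ℓ]) (Nat.succ_pos _)]
    exact ht₀.2
  classical
  -- A discrete intermediate value argument: `j` is the first index with `t₀ ≤ τ j`, and `i` is its
  -- predecessor. Then `g (τ i)` and `g (τ j)` are close, so the lower quasigeodesic bound puts `t₀`
  -- close to `τ i`.
  obtain ⟨i, j, hij, hi1, hi2⟩ : ∃ i j : ℕ, |min (i : ℝ) ℓ - min (j : ℝ) ℓ| ≤ 1 ∧ τ i ≤ t₀ ∧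
      t₀ ≤ τ j := by
    rcases Nat.eq_zero_or_pos (Nat.find hfind) with h | h
    · exact ⟨0, 0, by simp, by rw [hτ0 0 rfl]; exact ht₀.1, h ▸ Nat.find_spec hfind⟩
    · obtain ⟨k, hk⟩ : ∃ k, Nat.find hfind = k + 1 := ⟨Nat.find hfind - 1, by omega⟩
      refine ⟨k, k + 1, ?_, ?_, hk ▸ Nat.find_spec hfind⟩
      · refine (abs_min_sub_min_le_max _ _ _ _).trans ?_
        simp
      · exact (not_le.1 (Nat.find_min hfind (by omega : k < Nat.find hfind))).le
  have hmem : ∀ i : ℕ, min (i : ℝ) ℓ ∈ Icc 0 ℓ := fun i => ⟨by positivity, min_le_right _ _⟩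
  have hd := hσ _ (hmem i) _ (hmem j)
  have htri := dist_triangle4 (g (τ i)) (σ (min i ℓ)) (σ (min j ℓ)) (g (τ j))
  rw [dist_comm (g (τ i)) (σ _)] at htri
  have hlow := hg.lower _ (hτ i) _ (hτ j)
  have hb1 := hτd i
  have hb2 := hτd j
  rw [abs_of_nonpos (by linarith : τ i - τ j ≤ 0)] at hlow
  have hgap : t₀ - τ i ≤ (2 * H + 2) / lam * K := by
    rw [div_mul_eq_mul_div, le_div_iff₀ hlam]
    nlinarith
  have hup := hg.upper _ ht₀ _ (hτ i)
  rw [abs_of_nonneg (by linarith)] at hup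
  have hz := hσ'.gromovProduct_eq_zero le_rfl (hmem i).1 (hmem i).2 le_rfl
  rw [hσ0, hσ1] at hz
  have h1 := gromovProduct_le_add_dist (g t₀) (σ (min i ℓ)) (g 0) (g L)
  have h2 := dist_triangle (g t₀) (g (τ i)) (σ (min i ℓ))
  rw [dist_comm (g (τ i)) (σ _)] at h2
  have h3 := mul_le_mul_of_nonneg_left hgap hlam'.le
  linarith

end Morse

/-! ### Sublinearly biLipschitz maps and Gromov products -/

section Sublinear

variable {X Y : Type*} [MetricSpace X] [MetricSpace Y]

/-- The two-sided inequality of a sublinearly biLipschitz equivalence, with the explicit error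
`C * u`. -/
structure IsSublinearlyBilipschitz (o : X) (lam lam' C : ℝ) (u : ℝ → ℝ) (f : X → Y) : Prop where
  one_le : 1 ≤ C
  upper : ∀ x x', dist (f x) (f x') ≤ lam' * dist x x' + C * u (max (dist o x) (dist o x'))
  lower : ∀ x x', lam * dist x x' - C * u (max (dist o x) (dist o x')) ≤ dist (f x) (f x')

theorem IsSBE.exists_isSublinearlyBilipschitz {o : X} {p : Y} {lam lam' : ℝ} {u : ℝ → ℝ}
    {f : X → Y} (hu : Admissible u) (hf : IsSBE o p lam lam' u f) :
    ∃ C, IsSublinearlyBilipschitz o lam lam' C u f := by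
  obtain ⟨v, hv, hvu, h⟩ := hf.lipschitz
  obtain ⟨w, hw, hwu, h'⟩ := hf.expansive
  obtain ⟨C, hC, hCv⟩ := hu.exists_bound_of_isBigO hv hvu
  obtain ⟨C', -, hCw⟩ := hu.exists_bound_of_isBigO hw hwu
  have h0 : ∀ x x' : X, 0 ≤ max (dist o x) (dist o x') := fun x x' =>
    dist_nonneg.trans (le_max_left _ _)
  refine ⟨max C C', hC.trans (le_max_left _ _), fun x x' => ?_, fun x x' => ?_⟩
  · have := hCv _ (h0 x x')
    have := mul_le_mul_of_nonneg_right (le_max_left C C')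
      (zero_le_one.trans (hu.one_le _ (h0 x x')))
    linarith [h x x']
  · have := hCw _ (h0 x x')
    have := mul_le_mul_of_nonneg_right (le_max_right C C')
      (zero_le_one.trans (hu.one_le _ (h0 x x')))
    linarith [h' x x']

variable {δ : ℝ} {o : X} {lam lam' C : ℝ} {u : ℝ → ℝ} {f : X → Y}

/-- The Morse lemma for the image of a geodesic in a ball. -/
theorem IsSublinearlyBilipschitz.exists_gromovProduct_le_ball (hX : IsHyperbolic δ X)
    (hXg : IsGeodesicSpace X) (hY : IsHyperbolic δ Y) (hYg : IsGeodesicSpace Y)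
    (hu : Admissible u) (hlam : 0 < lam) (hlam' : 0 < lam')
    (hf : IsSublinearlyBilipschitz o lam lam' C u f) {κ : ℝ} (hκ : 0 ≤ κ) :
    ∃ C', 0 ≤ C' ∧ ∀ x y z R, dist o x ≤ R → dist o y ≤ R → dist o z ≤ R →
      gromovProduct x y z ≤ κ → gromovProduct (f x) (f y) (f z) ≤ C' * u R := by
  have hδ := hX.nonneg o
  have hC := hf.one_le
  obtain ⟨H, hH0, hH⟩ := exists_gromovProduct_le_of_quasigeodesic hY hYg hlam hlam'
  obtain ⟨D, hD1, hD⟩ := hu.exists_le_mul 3 0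
  refine ⟨H * (C * D) + lam' * (κ + 2 * δ) + C * D, by positivity, ?_⟩
  intro x y z R hx hy hz hxyz
  have hR0 : 0 ≤ R := dist_nonneg.trans hx
  have huR := hu.one_le R hR0
  obtain ⟨c, hc0, hc1, hc⟩ := hXg y z
  have hL : (0 : ℝ) ≤ dist y z := dist_nonneg
  have hL2 : dist y z ≤ 2 * R := by
    have := dist_triangle_left y z o
    linarith
  have hball : ∀ s ∈ Icc 0 (dist y z), dist o (c s) ≤ 3 * R := by
    intro s hs
    have h1 := hc 0 ⟨le_rfl, hL⟩ s hs
    have h2 := dist_triangle o y (c s)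
    rw [hc0, zero_sub, abs_neg, abs_of_nonneg hs.1] at h1
    linarith [hs.2]
  have hK : ∀ x y : X, dist o x ≤ 3 * R → dist o y ≤ 3 * R →
      C * u (max (dist o x) (dist o y)) ≤ C * D * u R := by
    intro x y hx hy
    rw [mul_assoc]
    exact mul_le_mul_of_nonneg_left (hD R _ hR0 (dist_nonneg.trans (le_max_left _ _))
      (by rw [add_zero]; exact max_le hx hy)) (by linarith)
  have hCD : 1 ≤ C * D := by nlinarith
  have hK1 : 1 ≤ C * D * u R := by nlinarith
  -- The geodesic `[y, z]` stays in the ball of radius `3 * R`, where doubling bounds all errors by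
  -- a multiple of `u R`.
  have hg : IsQuasigeodesicOn lam lam' (C * D * u R) (dist y z) (f ∘ c) := by
    constructor
    · intro s hs t ht
      have h1 := hf.upper (c s) (c t)
      have h2 := hK _ _ (hball s hs) (hball t ht)
      rw [hc s hs t ht] at h1
      exact h1.trans (by linarith)
    · intro s hs t ht
      have h1 := hf.lower (c s) (c t)
      have h2 := hK _ _ (hball s hs) (hball t ht)
      rw [hc s hs t ht] at h1
      exact le_trans (by linarith) h1
  have ht := gromovProduct_mem_Icc x y z
  set t := gromovProduct y x z
  have hmorse := hH _ _ _ hK1 hL hg t ht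
  simp only [Function.comp, hc0, hc1] at hmorse
  have h1 := hc 0 ⟨le_rfl, hL⟩ t ht
  have h2 := hc t ht _ ⟨hL, le_rfl⟩
  rw [hc0, zero_sub, abs_neg, abs_of_nonneg ht.1] at h1
  rw [hc1, abs_of_nonpos (by linarith [ht.2])] at h2
  have h3 := (hX.center_estimates (x := x) (p := c t) h1 (by rw [h2]; ring)).1
  have h4 := hf.upper x (c t)
  have h5 := hK x (c t) (by linarith) (hball t ht)
  have h6 := gromovProduct_le_add_dist (f x) (f (c t)) (f y) (f z)
  have h7 : lam' * dist x (c t) ≤ lam' * (κ + 2 * δ) * u R := by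
    have : lam' * dist x (c t) ≤ lam' * (κ + 2 * δ) :=
      mul_le_mul_of_nonneg_left (by linarith) hlam'.le
    have h0 : 0 ≤ lam' * (κ + 2 * δ) := by positivity
    nlinarith
  linarith

/-- Images of geodesics leaving `x` make linear progress beyond the scale `|x|`. -/
theorem IsSublinearlyBilipschitz.exists_le_gromovProduct_far (hX : IsHyperbolic δ X)
    (hXg : IsGeodesicSpace X) (hY : IsHyperbolic δ Y) (hYg : IsGeodesicSpace Y)
    (hu : Admissible u) (hlam : 0 < lam) (hlam' : 0 < lam')
    (hf : IsSublinearlyBilipschitz o lam lam' C u f) :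
    ∃ R₀, 0 ≤ R₀ ∧ ∀ x y w, dist o x ≤ dist x w → R₀ ≤ dist x w →
      dist x w + dist w y = dist x y →
      lam / 2 * dist x w - δ ≤ gromovProduct (f x) (f y) (f w) := by
  have hδ := hX.nonneg o
  have hC := hf.one_le
  obtain ⟨C₀, hC₀, hball⟩ := hf.exists_gromovProduct_le_ball hX hXg hY hYg hu hlam hlam' le_rfl
  obtain ⟨K, hK0, hK⟩ := hu.exists_le_mul_add (ε := lam / (12 * (C + C₀))) (by positivity)
  refine ⟨4 * ((C + C₀) * K + δ) / lam, by positivity, ?_⟩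
  -- When `y` is at most twice as far as `w`, everything lies within `3 * dist x w` of `o`. The ball
  -- estimate at `w` then costs only a small multiple of `dist x w`.
  have hbase : ∀ x y w, dist o x ≤ dist x w → 4 * ((C + C₀) * K + δ) / lam ≤ dist x w →
      dist x w + dist w y = dist x y → dist x y ≤ 2 * dist x w →
      lam / 2 * dist x w ≤ gromovProduct (f x) (f y) (f w) := by
    intro x y w h1 h2 h3 h4
    rw [div_le_iff₀ hlam] at h2
    have hw0 : 0 ≤ dist x w := dist_nonneg
    have hw : dist o w ≤ 3 * dist x w := by linarith [dist_triangle o x w]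
    have hy : dist o y ≤ 3 * dist x w := by linarith [dist_triangle o x y]
    have h5 := hball w x y (3 * dist x w) hw (by linarith) hy
      (by unfold gromovProduct; rw [dist_comm y w]; linarith)
    have h6 := hf.lower x w
    have h7 : u (max (dist o x) (dist o w)) ≤ u (3 * dist x w) :=
      hu.mono (mem_Ici.2 (dist_nonneg.trans (le_max_left _ _))) (mem_Ici.2 (by positivity))
        (max_le (by linarith) hw)
    have h8 := hK (3 * dist x w) (by positivity)
    have h9 := gromovProduct_add (f x) (f w) (f y)
    rw [gromovProduct_comm (f x)] at h9
    have h10 : (C + C₀) * u (3 * dist x w) ≤ lam / 4 * dist x w + (C + C₀) * K := by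
      calc (C + C₀) * u (3 * dist x w)
          ≤ (C + C₀) * (lam / (12 * (C + C₀)) * (3 * dist x w) + K) :=
            mul_le_mul_of_nonneg_left h8 (by linarith)
        _ = _ := by field_simp; ring
    have h11 : C * u (max (dist o x) (dist o w)) ≤ C * u (3 * dist x w) :=
      mul_le_mul_of_nonneg_left h7 (by linarith)
    linarith
  have main : ∀ (n : ℕ) (x y w : X), dist o x ≤ dist x w →
      4 * ((C + C₀) * K + δ) / lam ≤ dist x w → dist x w + dist w y = dist x y →
      dist x y ≤ 2 ^ n * dist x w →
      lam / 2 * dist x w - δ ≤ gromovProduct (f x) (f y) (f w) := by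
    intro n
    induction n with
    | zero =>
      intro x y w h1 h2 h3 h4
      have hw0 : 0 ≤ dist x w := dist_nonneg
      have := hbase x y w h1 h2 h3 (by simp at h4; linarith)
      linarith
    | succ n ih =>
      intro x y w h1 h2 h3 h4
      have hw0 : 0 ≤ dist x w := dist_nonneg
      rcases le_or_gt (dist x y) (2 * dist x w) with h | h
      · linarith [hbase x y w h1 h2 h3 h]
      obtain ⟨w', hw1, hw2⟩ := hXg.exists_between w y hw0 (by linarith)
      have hw' : dist x w' = 2 * dist x w := by
        have := dist_triangle x w w'
        have := dist_triangle x w' y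
        linarith
      -- The losses do not accumulate: the bound at `w'` is `lam * dist x w - δ`, still above `lam /
      -- 2 * dist x w`, so comparing it with the step from `w'` to `w` loses a single `δ` again.
      have ha := ih x y w' (by linarith) (by linarith) (by linarith)
        (by rw [hw']; rw [pow_succ] at h4; linarith)
      have hb := hbase x w' w h1 h2 (by linarith) (by linarith)
      have hr : 4 * δ ≤ lam * dist x w := by
        rw [div_le_iff₀ hlam] at h2
        have : 0 ≤ (C + C₀) * K := by positivity
        linarith
      rw [hw'] at ha
      exact hY.le_of_le (a := lam / 2 * dist x w) (by linarith) hb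
  intro x y w h1 h2 h3
  rcases eq_or_lt_of_le (dist_nonneg : 0 ≤ dist x w) with h | h
  · have := gromovProduct_nonneg (f x) (f y) (f w)
    rw [← h]; linarith
  · obtain ⟨n, hn⟩ := pow_unbounded_of_one_lt (dist x y / dist x w) one_lt_two
    exact main n x y w h1 h2 h3 (by rw [div_lt_iff₀ h] at hn; exact hn.le)

/-- The sublinear Morse lemma: the image of a geodesic through `x` passes within `O(u(|x|))`
of the image of `x`. -/
theorem IsSublinearlyBilipschitz.exists_gromovProduct_le (hX : IsHyperbolic δ X)
    (hXg : IsGeodesicSpace X) (hY : IsHyperbolic δ Y) (hYg : IsGeodesicSpace Y)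
    (hu : Admissible u) (hlam : 0 < lam) (hlam' : 0 < lam')
    (hf : IsSublinearlyBilipschitz o lam lam' C u f) {κ : ℝ} (hκ : 0 ≤ κ) :
    ∃ C', 0 ≤ C' ∧ ∀ x y z, gromovProduct x y z ≤ κ →
      gromovProduct (f x) (f y) (f z) ≤ C' * u (dist o x) := by
  have hδ := hX.nonneg o
  obtain ⟨R₀, hR₀, hfar⟩ := hf.exists_le_gromovProduct_far hX hXg hY hYg hu hlam hlam'
  obtain ⟨C₁, hC₁, hball⟩ := hf.exists_gromovProduct_le_ball hX hXg hY hYg hu hlam hlam' hκ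
  obtain ⟨K, hK0, hK⟩ := hu.exists_le_mul_add (ε := lam / (8 * (C₁ + 1))) (by positivity)
  set R₁ := max R₀ (4 * (C₁ * K + 3 * δ + 1) / lam) with hR₁
  have hR₁0 : 0 ≤ R₁ := hR₀.trans (le_max_left _ _)
  obtain ⟨D, hD1, hD⟩ := hu.exists_le_mul 2 (2 * R₁)
  refine ⟨C₁ * D + 2 * δ, by positivity, ?_⟩
  intro x y z hxyz
  have hx0 : 0 ≤ dist o x := dist_nonneg
  have hux := hu.one_le _ hx0
  set r := max (dist o x) R₁ with hr
  have hrx : dist o x ≤ r := le_max_left _ _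
  have hr1 : R₁ ≤ r := le_max_right _ _
  have hr0 : 0 ≤ r := hx0.trans hrx
  -- At radius `r` the linear progress beats the sublinear error. For `y` beyond that radius, this
  -- excludes one alternative of the four-point inequality, so replacing the cut-off point `y'` by
  -- `y` costs only `δ`; likewise for `z`.
  have hB : C₁ * u (2 * r) + 2 * δ < lam / 2 * r - δ := by
    have h1 := hK (2 * r) (by positivity)
    have h2 : C₁ * u (2 * r) ≤ lam / 4 * r + C₁ * K := by
      calc C₁ * u (2 * r) ≤ C₁ * (lam / (8 * (C₁ + 1)) * (2 * r) + K) :=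
            mul_le_mul_of_nonneg_left h1 hC₁
        _ = C₁ / (C₁ + 1) * (lam / 4 * r) + C₁ * K := by field_simp; ring
        _ ≤ 1 * (lam / 4 * r) + C₁ * K := by
            gcongr
            rw [div_le_one (by linarith)]; linarith
        _ = _ := by ring
    have h3 : 4 * (C₁ * K + 3 * δ + 1) / lam ≤ r := (le_max_right _ _).trans hr1
    rw [div_le_iff₀ hlam] at h3
    linarith
  have hpt : ∀ y, ∃ y', dist x y' ≤ r ∧ dist x y' + dist y' y = dist x y ∧
      (y' = y ∨ lam / 2 * r - δ ≤ gromovProduct (f x) (f y) (f y')) := by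
    intro y
    rcases le_total (dist x y) r with h | h
    · exact ⟨y, h, by simp, Or.inl rfl⟩
    · obtain ⟨w, hw, hw'⟩ := hXg.exists_between x y hr0 h
      refine ⟨w, hw.le, by linarith, Or.inr ?_⟩
      have := hfar x y w (by rw [hw]; exact hrx)
        (by rw [hw]; exact (le_max_left _ _).trans hr1) (by linarith)
      rwa [hw] at this
  obtain ⟨y', hy1, hy2, hy3⟩ := hpt y
  obtain ⟨z', hz1, hz2, hz3⟩ := hpt z
  have hyz : gromovProduct x y' z' ≤ κ := by
    refine le_trans ?_ hxyz
    have := dist_triangle4 y y' z' z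
    rw [dist_comm y y'] at this
    unfold gromovProduct
    rw [dist_comm y' x, dist_comm z' x, dist_comm y x, dist_comm z x]
    linarith
  have h1 := hball x y' z' (2 * r) (by linarith) (by linarith [dist_triangle o x y'])
    (by linarith [dist_triangle o x z']) hyz
  have h2 : gromovProduct (f x) (f y) (f z') ≤ C₁ * u (2 * r) + δ := by
    rcases hy3 with rfl | hy3
    · linarith
    · rcases hY.le_or_le (y := f y) h1 with h | h
      · rw [gromovProduct_comm] at h; linarith
      · exact h
  have h3 : gromovProduct (f x) (f y) (f z) ≤ C₁ * u (2 * r) + 2 * δ := by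
    rcases hz3 with rfl | hz3
    · linarith
    · rcases hY.le_or_le (y := f z) h2 with h | h
      · linarith
      · linarith
  have h4 := hD (dist o x) (2 * r) hx0 (by positivity) (by
    have : r ≤ dist o x + R₁ := max_le (by linarith) (by linarith)
    linarith)
  nlinarith

/-- A sublinearly biLipschitz map coarsely preserves Gromov products. -/
theorem IsSublinearlyBilipschitz.exists_gromovProduct_estimates (hX : IsHyperbolic δ X)
    (hXg : IsGeodesicSpace X) (hY : IsHyperbolic δ Y) (hYg : IsGeodesicSpace Y)
    (hu : Admissible u) (hlam : 0 < lam) (hlam' : 0 < lam')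
    (hf : IsSublinearlyBilipschitz o lam lam' C u f) :
    ∃ C', 0 ≤ C' ∧ ∀ x y z,
      lam * gromovProduct z x y - C' * u (dist o z + gromovProduct z x y) ≤
        gromovProduct (f z) (f x) (f y) ∧
      gromovProduct (f z) (f x) (f y) ≤
        lam' * gromovProduct z x y + C' * u (dist o z + gromovProduct z x y) := by
  have hδ := hX.nonneg o
  have hC := hf.one_le
  obtain ⟨C₁, hC₁, hG⟩ := hf.exists_gromovProduct_le hX hXg hY hYg hu hlam hlam' hδ
  obtain ⟨D, hD1, hD⟩ := hu.exists_le_mul 1 (2 * δ)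
  refine ⟨C₁ * D + C * D + δ + lam' * (2 * δ), by positivity, ?_⟩
  intro x y z
  -- The distance from `z` to the center `m` is `(x ∣ y)_z` up to `2 * δ`. The three products at `f
  -- m` are `O(u(|m|))`, so `(f x ∣ f y)_{f z}` is `dist (f z) (f m)` up to that error.
  obtain ⟨m, hm1, hm2, hm3, hm4⟩ := hXg.exists_center hX z x y
  set b := gromovProduct z x y with hb
  have hb0 : 0 ≤ b := gromovProduct_nonneg _ _ _
  have hz0 : 0 ≤ dist o z := dist_nonneg
  have hm : dist o m ≤ 1 * (dist o z + b) + 2 * δ := by linarith [dist_triangle o z m]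
  have hW := hu.one_le (dist o z + b) (by positivity)
  have hum := hD (dist o z + b) (dist o m) (by positivity) dist_nonneg hm
  have huzm := hD (dist o z + b) (max (dist o z) (dist o m)) (by positivity)
    (hz0.trans (le_max_left _ _)) (max_le (by linarith) hm)
  set W := u (dist o z + b)
  have hum' := mul_le_mul_of_nonneg_left hum hC₁
  have huzm' := mul_le_mul_of_nonneg_left huzm (by linarith : 0 ≤ C)
  have hbm : b ≤ dist z m := by
    have := gromovProduct_le_add_dist z m x y
    rw [hm2] at this; linarith
  have hδW : δ ≤ δ * W := by nlinarith
  have hlW : lam' * (2 * δ) ≤ lam' * (2 * δ) * W := by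
    have : 0 ≤ lam' * (2 * δ) := by positivity
    nlinarith
  have hl1 := mul_le_mul_of_nonneg_left hbm hlam.le
  have hl2 := mul_le_mul_of_nonneg_left hm1 hlam'.le
  constructor
  · have h1 := hG m z x hm3
    have h2 := hG m z y hm4
    have h3 := gromovProduct_add (f z) (f m) (f x)
    have h4 := gromovProduct_add (f z) (f m) (f y)
    have h5 := hf.lower z m
    rw [gromovProduct_comm (f z)] at h3
    have h6 := hY.le_of_le (p := f z) (a := dist (f z) (f m) - C₁ * u (dist o m)) (x := f x)
      (y := f m) (z := f y) (by linarith) (by linarith)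
    have : 0 ≤ lam' * (2 * δ) * W := by positivity
    linarith
  · have h1 := hG m x y (by linarith)
    have h2 := gromovProduct_le_add_dist (f z) (f m) (f x) (f y)
    have h3 := hf.upper z m
    linarith

end Sublinear

/-! ### Cross-differences of four points -/

section CrossDifference

variable {X Y : Type*} [MetricSpace X] [MetricSpace Y] {δ : ℝ}

/-- Seen from the center `m`, the point `o` can share a direction with at most one of `a`, `b`, `c`.
For the other two, the way from `o` passes near `m`, so their product at `o` is almost `dist o m`.
-/
theorem IsHyperbolic.dist_le_of_center (hX : IsHyperbolic δ X) {o m a b c : X} {M : ℝ}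
    (hab : gromovProduct m a b ≤ δ) (hac : gromovProduct m a c ≤ δ) (hbc : gromovProduct m b c ≤ δ)
    (hab' : gromovProduct o a b ≤ M) (hac' : gromovProduct o a c ≤ M)
    (hbc' : gromovProduct o b c ≤ M) : dist o m ≤ M + 3 * δ := by
  have key : ∀ x y : X, gromovProduct m x o ≤ 2 * δ → gromovProduct m y o ≤ 2 * δ →
      gromovProduct o x y ≤ M → dist o m ≤ M + 3 * δ := by
    intro x y hx hy hxy
    have h1 := gromovProduct_add o m x
    have h2 := gromovProduct_add o m y
    rw [gromovProduct_comm m] at h1 h2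
    rw [gromovProduct_comm o] at h1
    have := hX.le_of_le (a := dist o m - 2 * δ) (by linarith : _ ≤ gromovProduct o x m)
      (by linarith : _ ≤ gromovProduct o m y)
    linarith
  have h1 := hX.le_or_le (y := o) hab
  have h2 := hX.le_or_le (y := o) hac
  have h3 := hX.le_or_le (y := o) hbc
  rw [gromovProduct_comm m o, ← two_mul] at h1 h2 h3
  rcases h1 with h1 | h1
  · rcases h3 with h3 | h3
    · exact key _ _ h1 h3 hab'
    · exact key _ _ h1 h3 hac'
  · rcases h2 with h2 | h2
    · exact key _ _ h2 h1 hab'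
    · exact key _ _ h1 h2 hbc'

/-- The logarithm of a cross-ratio, in terms of a symmetric function such as the Gromov product. -/
def crossDifference (b : Fin 4 → Fin 4 → ℝ) : ℝ :=
  b 0 3 + b 1 2 - b 0 2 - b 1 3

variable {o : X} {lam lam' C : ℝ} {u : ℝ → ℝ} {f : X → Y}

theorem IsSublinearlyBilipschitz.exists_crossDifference_estimates (hX : IsHyperbolic δ X)
    (hXg : IsGeodesicSpace X) (hY : IsHyperbolic δ Y) (hYg : IsGeodesicSpace Y)
    (hu : Admissible u) (hlam : 0 < lam) (hlam' : 0 < lam')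
    (hf : IsSublinearlyBilipschitz o lam lam' C u f) (p : Y) :
    ∃ C', 0 ≤ C' ∧ ∀ (x : Fin 4 → X) (M : ℝ), 0 ≤ M →
      (∀ i j, i ≠ j → gromovProduct o (x i) (x j) ≤ M) →
      lam * max 0 (crossDifference fun i j => gromovProduct o (x i) (x j)) - C' * u M ≤
        max 0 (crossDifference fun i j => gromovProduct p (f (x i)) (f (x j))) ∧
      max 0 (crossDifference fun i j => gromovProduct p (f (x i)) (f (x j))) ≤
        lam' * max 0 (crossDifference fun i j => gromovProduct o (x i) (x j)) + C' * u M := by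
  have hδ := hX.nonneg o
  obtain ⟨C₁, hC₁, hP⟩ := hf.exists_gromovProduct_estimates hX hXg hY hYg hu hlam hlam'
  obtain ⟨D, hD1, hD⟩ := hu.exists_le_mul 3 (6 * δ)
  refine ⟨4 * (lam + lam') * δ + 3 * (C₁ * D), by positivity, ?_⟩
  intro x M hM hxM
  have huM := hu.one_le M hM
  obtain ⟨m, -, h13, h01, h03⟩ := hXg.exists_center hX (x 0) (x 1) (x 3)
  have hm : dist o m ≤ M + 3 * δ := hX.dist_le_of_center h01 h03 (by linarith)
    (hxM 0 1 (by decide)) (hxM 0 3 (by decide)) (hxM 1 3 (by decide))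
  have hm0 : 0 ≤ dist o m := dist_nonneg
  have n03 := gromovProduct_nonneg m (x 0) (x 3)
  have n02 := gromovProduct_nonneg m (x 0) (x 2)
  have n12 := gromovProduct_nonneg m (x 1) (x 2)
  have n13 := gromovProduct_nonneg m (x 1) (x 3)
  have hA : crossDifference (fun i j => gromovProduct o (x i) (x j)) =
      gromovProduct m (x 0) (x 3) + gromovProduct m (x 1) (x 2) -
        gromovProduct m (x 0) (x 2) - gromovProduct m (x 1) (x 3) :=
    gromovProduct_double_difference _ _ _ _ _ _
  have hB : crossDifference (fun i j => gromovProduct p (f (x i)) (f (x j))) =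
      gromovProduct (f m) (f (x 0)) (f (x 3)) + gromovProduct (f m) (f (x 1)) (f (x 2)) -
        gromovProduct (f m) (f (x 0)) (f (x 2)) - gromovProduct (f m) (f (x 1)) (f (x 3)) :=
    gromovProduct_double_difference _ _ _ _ _ _
  have hAM : crossDifference (fun i j => gromovProduct o (x i) (x j)) ≤ 2 * M := by
    have := hxM 0 3 (by decide)
    have := hxM 1 2 (by decide)
    have := gromovProduct_nonneg o (x 0) (x 2)
    have := gromovProduct_nonneg o (x 1) (x 3)
    simp only [crossDifference]; linarith
  -- One of `(x 0 ∣ x 2)_m`, `(x 1 ∣ x 2)_m` is at most `2 * δ`, and `(x 0 ∣ x 3)_m`, `(x 1 ∣ x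
  -- 3)_m` are at most `δ`. Hence `max 0 A` is `(x 1 ∣ x 2)_m` up to a multiple of `δ`.
  have hor := hX.le_or_le (y := x 2) h01
  rw [gromovProduct_comm m (x 2)] at hor
  set A := crossDifference fun i j => gromovProduct o (x i) (x j)
  set B := crossDifference fun i j => gromovProduct p (f (x i)) (f (x j))
  have hA0 : 0 ≤ max 0 A := le_max_left _ _
  have hA1 : A ≤ max 0 A := le_max_right _ _
  have hB0 : 0 ≤ max 0 B := le_max_left _ _
  have hB1 : B ≤ max 0 B := le_max_right _ _
  have h12 : gromovProduct m (x 1) (x 2) ≤ max 0 A + 3 * δ := by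
    rcases hor with h | h <;> linarith
  have hA2M : max 0 A ≤ 2 * M := max_le (by linarith) hAM
  have hPm : ∀ i j, gromovProduct m (x i) (x j) ≤ 2 * M + 3 * δ →
      C₁ * u (dist o m + gromovProduct m (x i) (x j)) ≤ C₁ * D * u M := by
    intro i j hij
    rw [mul_assoc]
    exact mul_le_mul_of_nonneg_left (hD _ _ hM (add_nonneg hm0 (gromovProduct_nonneg _ _ _))
      (by linarith)) hC₁
  have hδu : δ ≤ δ * u M := by nlinarith
  have hlu : lam * δ ≤ lam * δ * u M := by
    have : 0 ≤ lam * δ := by positivity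
    nlinarith
  have hlu' : lam' * δ ≤ lam' * δ * u M := by
    have : 0 ≤ lam' * δ := by positivity
    nlinarith
  have hCu : 0 ≤ C₁ * D * u M := by positivity
  have hlun : 0 ≤ lam * δ * u M := by positivity
  have hlun' : 0 ≤ lam' * δ * u M := by positivity
  constructor
  -- A cross-difference of at most `3 * δ` is absorbed by the constant. A larger one forces the
  -- small product in `hor` to be `(x 0 ∣ x 2)_m`, so that the subtracted products of the images are
  -- also small.
  · rcases le_or_gt A (3 * δ) with hs | hs
    · have : max 0 A ≤ 3 * δ := max_le (by linarith) hs
      have := mul_le_mul_of_nonneg_left this hlam.le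
      linarith
    · have h02 : gromovProduct m (x 0) (x 2) ≤ 2 * δ := by
        rcases hor with h | h <;> linarith
      rw [max_eq_right (by linarith : 0 ≤ A)]
      have e1 := (hP (x 1) (x 2) m).1
      have e2 := (hP (x 0) (x 2) m).2
      have e3 := (hP (x 1) (x 3) m).2
      have e4 := hPm 1 2 (by linarith)
      have e5 := hPm 0 2 (by linarith)
      have e6 := hPm 1 3 (by linarith)
      have e7 := gromovProduct_nonneg (f m) (f (x 0)) (f (x 3))
      have e8 := mul_le_mul_of_nonneg_left h02 hlam'.le
      have e9 := mul_le_mul_of_nonneg_left (by linarith : gromovProduct m (x 1) (x 3) ≤ δ) hlam'.le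
      have e10 := mul_le_mul_of_nonneg_left
        (by linarith : A - δ ≤ gromovProduct m (x 1) (x 2)) hlam.le
      linarith
  · refine max_le (by positivity) ?_
    have e1 := (hP (x 1) (x 2) m).2
    have e2 := (hP (x 0) (x 3) m).2
    have e4 := hPm 1 2 (by linarith)
    have e5 := hPm 0 3 (by linarith)
    have e6 := gromovProduct_nonneg (f m) (f (x 0)) (f (x 2))
    have e7 := gromovProduct_nonneg (f m) (f (x 1)) (f (x 3))
    have e8 := mul_le_mul_of_nonneg_left h12 hlam'.le
    have e9 := mul_le_mul_of_nonneg_left h03 hlam'.le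
    linarith

end CrossDifference

/-! ### The Gromov boundary and its visual metrics -/

section Boundary

variable {X Y : Type*} [MetricSpace X] [MetricSpace Y] {δ ν : ℝ} {o : X} {p : Y}

theorem GromovBoundary.exists_mk (ξ : GromovBoundary o) :
    ∃ x : CauchyGromovSeq o, GromovBoundary.mk x = ξ :=
  Quot.exists_rep ξ

theorem coe_toReal_boundaryProduct {ξ η : GromovBoundary o} (h : ξ ≠ η) :
    (((boundaryProduct ξ η).toReal : ℝ) : EReal) = boundaryProduct ξ η :=
  EReal.coe_toReal (fun ht => h (eq_of_boundaryProduct_eq_top ht))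
    ((EReal.bot_lt_zero).trans_le (boundaryProduct_nonneg ξ η)).ne'

theorem toReal_boundaryProduct_nonneg (ξ η : GromovBoundary o) :
    0 ≤ (boundaryProduct ξ η).toReal :=
  EReal.toReal_nonneg (boundaryProduct_nonneg ξ η)

theorem eventually_lt_gromovProduct_of_seqEquiv (hX : IsHyperbolic δ X) {x y : CauchyGromovSeq o}
    (h : SeqEquiv o x y) (B : ℝ) :
    ∃ N, ∀ n ≥ N, ∀ m ≥ N, B < gromovProduct o (x.1 n) (y.1 m) := by
  obtain ⟨N₁, hN₁⟩ := eventually_atTop.1 (tendsto_atTop.1 h (B + δ + 1))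
  obtain ⟨N₂, hN₂⟩ := eventually_atTop.1 (tendsto_atTop.1 y.2 (B + δ + 1))
  refine ⟨max N₁ (max N₂.1 N₂.2), fun n hn m hm => ?_⟩
  simp only [ge_iff_le, max_le_iff] at hn hm
  have := hX.le_of_le (hN₁ n hn.1) (hN₂ (n, m) ⟨hn.2.1, hm.2.2⟩)
  linarith

/-- The boundary product is an infimum over representatives, but changing both representatives costs
only `2 * δ`. Hence any chosen pair of sequences computes it up to a bounded error. -/
theorem eventually_gromovProduct_bounds (hX : IsHyperbolic δ X) {x y : CauchyGromovSeq o}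
    (h : GromovBoundary.mk x ≠ GromovBoundary.mk y) :
    ∀ᶠ n in atTop,
      (boundaryProduct (GromovBoundary.mk x) (GromovBoundary.mk y)).toReal - 1 ≤
        gromovProduct o (x.1 n) (y.1 n) ∧
      gromovProduct o (x.1 n) (y.1 n) ≤
        (boundaryProduct (GromovBoundary.mk x) (GromovBoundary.mk y)).toReal + (2 * δ + 1) := by
  have hb := coe_toReal_boundaryProduct h
  set b := (boundaryProduct (GromovBoundary.mk x) (GromovBoundary.mk y)).toReal with hbdef
  refine Filter.Eventually.and ?_ ?_
  · have h1 : boundaryProduct (GromovBoundary.mk x) (GromovBoundary.mk y) ≤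
        liminf (fun n => ((gromovProduct o (x.1 n) (y.1 n) : ℝ) : EReal)) atTop :=
      iInf_le_of_le x (iInf_le_of_le y (iInf_le_of_le rfl (iInf_le_of_le rfl le_rfl)))
    rw [← hb] at h1
    have h2 : ((b - 1 : ℝ) : EReal) < b := EReal.coe_lt_coe_iff.2 (by linarith)
    filter_upwards [eventually_lt_of_lt_liminf (h2.trans_le h1) (by isBoundedDefault)] with n hn
    exact (EReal.coe_lt_coe_iff.1 hn).le
  · have h1 : boundaryProduct (GromovBoundary.mk x) (GromovBoundary.mk y) < ((b + 1 : ℝ) : EReal) :=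
      by rw [← hb]; exact EReal.coe_lt_coe_iff.2 (by linarith)
    simp only [boundaryProduct, iInf_lt_iff] at h1
    obtain ⟨x', y', hx', hy', h1⟩ := h1
    obtain ⟨N₁, hN₁⟩ := eventually_lt_gromovProduct_of_seqEquiv hX
      ((GromovBoundary.mk_eq_mk_iff hX).1 hx') (b + (2 * δ + 1))
    obtain ⟨N₂, hN₂⟩ := eventually_lt_gromovProduct_of_seqEquiv hX
      ((GromovBoundary.mk_eq_mk_iff hX).1 hy'.symm) (b + (2 * δ + 1))
    filter_upwards [eventually_ge_atTop (max N₁ N₂)] with n hn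
    by_contra! hlt
    have hδ := hX.nonneg o
    refine absurd h1 (not_lt.2 (le_liminf_of_le (by isBoundedDefault) ?_))
    filter_upwards [eventually_ge_atTop (max N₁ N₂)] with m hm
    simp only [max_le_iff] at hn hm
    have e1 := hX.le_of_le (hN₁ m hm.1 n hn.1).le hlt.le
    have e2 := hX.le_of_le e1 (by linarith [hN₂ n hn.2 m hm.2] : _ ≤ gromovProduct o (y.1 n) (y'.1 m))
    exact EReal.coe_le_coe_iff.2 (by linarith)

theorem visualMetric_dist_bounds (hX : IsHyperbolic δ X) (hν : 1 < ν) (hνδ : ν ^ δ ≤ 2)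
    {ξ η : GromovBoundary o} (h : ξ ≠ η) :
    letI : MetricSpace (GromovBoundary o) := visualMetric o hX hν hνδ
    dist ξ η ≤ ν ^ (-(boundaryProduct ξ η).toReal) ∧
      ν ^ (-(boundaryProduct ξ η).toReal) ≤ 4 * dist ξ η := by
  have ht : boundaryProduct ξ η ≠ ⊤ := fun ht => h (eq_of_boundaryProduct_eq_top ht)
  have hk : (visualKernel ν ξ η : ℝ) = ν ^ (-(boundaryProduct ξ η).toReal) := by
    rw [visualKernel, if_neg ht, Real.coe_toNNReal _ (Real.rpow_nonneg (by linarith) _)]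
  rw [← hk]
  exact ⟨PseudoMetricSpace.dist_ofPreNNDist_le _ _ _ _ _,
    frink (visualKernel (o := o) ν) (visualKernel_self hX) visualKernel_comm
      (visualKernel_quasi hX hν hνδ) ξ η⟩

/-- A map between boundaries that expands Gromov products at most linearly is Hölder continuous. -/
theorem continuous_of_boundaryProduct (hX : IsHyperbolic δ X) (hY : IsHyperbolic δ Y) (hν : 1 < ν)
    (hνδ : ν ^ δ ≤ 2) {c K : ℝ} (hc : 0 < c) (ψ : GromovBoundary o → GromovBoundary p)
    (h : ∀ ξ η, ψ ξ ≠ ψ η →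
      c * (boundaryProduct ξ η).toReal - K ≤ (boundaryProduct (ψ ξ) (ψ η)).toReal) :
    letI : MetricSpace (GromovBoundary o) := visualMetric o hX hν hνδ
    letI : MetricSpace (GromovBoundary p) := visualMetric p hY hν hνδ
    Continuous ψ := by
  let : MetricSpace (GromovBoundary o) := visualMetric o hX hν hνδ
  let : MetricSpace (GromovBoundary p) := visualMetric p hY hν hνδ
  have hν0 : 0 < ν := by linarith
  have hle : ∀ ξ η, dist (ψ ξ) (ψ η) ≤ ν ^ K * (4 * dist ξ η) ^ c := by
    intro ξ η
    by_cases hψ : ψ ξ = ψ η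
    · rw [hψ, dist_self]; positivity
    · have hξη : ξ ≠ η := fun h => hψ (congrArg ψ h)
      calc dist (ψ ξ) (ψ η) ≤ ν ^ (-(boundaryProduct (ψ ξ) (ψ η)).toReal) :=
            (visualMetric_dist_bounds hY hν hνδ hψ).1
        _ ≤ ν ^ (K + -(boundaryProduct ξ η).toReal * c) :=
            Real.rpow_le_rpow_of_exponent_le hν.le (by linarith [h ξ η hψ])
        _ = ν ^ K * (ν ^ (-(boundaryProduct ξ η).toReal)) ^ c := by
            rw [Real.rpow_add hν0, Real.rpow_mul hν0.le]
        _ ≤ ν ^ K * (4 * dist ξ η) ^ c := by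
            gcongr
            exact (visualMetric_dist_bounds hX hν hνδ hξη).2
  refine continuous_iff_continuousAt.2 fun ξ => tendsto_iff_dist_tendsto_zero.2 ?_
  refine squeeze_zero (fun _ => dist_nonneg) (fun η => hle η ξ) ?_
  have h1 : Tendsto (fun η => dist η ξ) (𝓝 ξ) (𝓝 0) := tendsto_iff_dist_tendsto_zero.1 tendsto_id
  have h2 := (((h1.const_mul 4).rpow_const (p := c) (Or.inr hc.le)).const_mul (ν ^ K))
  simpa [Real.zero_rpow hc.ne'] using h2

/-! ### Cross-ratios as cross-differences -/

theorem logb_dist_bounds {Z : Type*} [MetricSpace Z] (hν : 1 < ν) {x y : Z} {b : ℝ}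
    (h : dist x y ≤ ν ^ (-b)) (h' : ν ^ (-b) ≤ 4 * dist x y) :
    -b - Real.logb ν 4 ≤ Real.logb ν (dist x y) ∧ Real.logb ν (dist x y) ≤ -b := by
  have hν0 : 0 < ν := by linarith
  have hpos : 0 < ν ^ (-b) := Real.rpow_pos_of_pos hν0 _
  have hd : 0 < dist x y := by linarith
  constructor
  · have := Real.logb_le_logb_of_le hν hpos h'
    rw [Real.logb_rpow hν0 hν.ne', Real.logb_mul (by norm_num) hd.ne'] at this
    linarith
  · have := Real.logb_le_logb_of_le hν hd h
    rwa [Real.logb_rpow hν0 hν.ne'] at this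

theorem abs_logb_crossRatio_sub_le {Z : Type*} [MetricSpace Z] (hν : 1 < ν) {ξ : Fin 4 → Z}
    {b : Fin 4 → Fin 4 → ℝ} (h : ∀ i j, i ≠ j → dist (ξ i) (ξ j) ≤ ν ^ (-b i j) ∧
      ν ^ (-b i j) ≤ 4 * dist (ξ i) (ξ j)) :
    |Real.logb ν (crossRatio ξ) - crossDifference b| ≤ 2 * Real.logb ν 4 := by
  have hne : ∀ i j, i ≠ j → dist (ξ i) (ξ j) ≠ 0 := fun i j hij h0 => by
    have := (h i j hij).2
    rw [h0, mul_zero] at this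
    exact absurd (Real.rpow_pos_of_pos (by linarith) _) (not_lt.2 this)
  have h02 := logb_dist_bounds hν (h 0 2 (by decide)).1 (h 0 2 (by decide)).2
  have h13 := logb_dist_bounds hν (h 1 3 (by decide)).1 (h 1 3 (by decide)).2
  have h03 := logb_dist_bounds hν (h 0 3 (by decide)).1 (h 0 3 (by decide)).2
  have h12 := logb_dist_bounds hν (h 1 2 (by decide)).1 (h 1 2 (by decide)).2
  have n02 := hne 0 2 (by decide)
  have n13 := hne 1 3 (by decide)
  have n03 := hne 0 3 (by decide)
  have n12 := hne 1 2 (by decide)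
  rw [crossRatio, Real.logb_div (mul_ne_zero n02 n13) (mul_ne_zero n03 n12),
    Real.logb_mul n02 n13, Real.logb_mul n03 n12, crossDifference, abs_le]
  constructor <;> linarith [h02.1, h02.2, h13.1, h13.2, h03.1, h03.2, h12.1, h12.2]

theorem abs_crossDifference_sub_le {b b' : Fin 4 → Fin 4 → ℝ} {T : ℝ}
    (h : ∀ i j, i ≠ j → |b i j - b' i j| ≤ T) :
    |crossDifference b - crossDifference b'| ≤ 4 * T := by
  have h02 := abs_le.1 (h 0 2 (by decide))
  have h13 := abs_le.1 (h 1 3 (by decide))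
  have h03 := abs_le.1 (h 0 3 (by decide))
  have h12 := abs_le.1 (h 1 2 (by decide))
  rw [crossDifference, crossDifference, abs_le]
  constructor <;> linarith [h02.1, h02.2, h13.1, h13.2, h03.1, h03.2, h12.1, h12.2]

theorem le_supPairs (F : Fin 4 → Fin 4 → ℝ) {i j : Fin 4} (h : i ≠ j) : F i j ≤ supPairs F := by
  refine le_csSup ?_ ⟨i, j, h, rfl⟩
  refine ((Set.finite_range fun q : Fin 4 × Fin 4 => F q.1 q.2).subset ?_).bddAbove
  rintro _ ⟨i, j, -, rfl⟩
  exact ⟨(i, j), rfl⟩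

end Boundary

/-! ### The boundary map -/

theorem Admissible.exists_mul_le {u : ℝ → ℝ} (hu : Admissible u) {C ε : ℝ} (hC : 0 ≤ C)
    (hε : 0 < ε) : ∃ K, 0 ≤ K ∧ ∀ r, 0 ≤ r → C * u r ≤ ε * r + K := by
  obtain ⟨K, hK0, hK⟩ := hu.exists_le_mul_add (ε := ε / (C + 1)) (by positivity)
  refine ⟨C * K, by positivity, fun r hr => ?_⟩
  calc C * u r ≤ C * (ε / (C + 1) * r + K) := mul_le_mul_of_nonneg_left (hK r hr) hC
    _ = C / (C + 1) * (ε * r) + C * K := by field_simp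
    _ ≤ 1 * (ε * r) + C * K := by
        gcongr
        rw [div_le_one (by linarith)]; linarith
    _ = _ := by ring

section BoundaryMap

variable {X Y : Type*} [MetricSpace X] [MetricSpace Y] {δ : ℝ} {o : X} {p : Y}
  {lam lam' C : ℝ} {u : ℝ → ℝ} {f : X → Y}

/-- `f x` is at distance at least about `lam * |x|` from `p`, while `f x` and `g x` are only
`O(u(|x|))` apart. Half of the linear term absorbs both sublinear errors. -/
theorem IsSublinearlyBilipschitz.exists_le_gromovProduct_of_isClose (hu : Admissible u)
    (hlam : 0 < lam) (hf : IsSublinearlyBilipschitz o lam lam' C u f) (p : Y) {g : X → Y}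
    (hg : IsClose o u f g) :
    ∃ K, ∀ x, lam / 2 * dist o x - K ≤ gromovProduct p (f x) (g x) := by
  obtain ⟨C', hC'⟩ := hg
  have hC := hf.one_le
  obtain ⟨K, -, hK⟩ := hu.exists_mul_le (C := C + |C'|) (by positivity) (half_pos hlam)
  refine ⟨K + dist p (f o), fun x => ?_⟩
  have h1 := hf.lower o x
  rw [dist_self, max_eq_right dist_nonneg] at h1
  have h2 := hK _ (dist_nonneg : 0 ≤ dist o x)
  have h3 := mul_le_mul_of_nonneg_right (le_abs_self C')
    (zero_le_one.trans (hu.one_le _ (dist_nonneg : 0 ≤ dist o x)))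
  have h4 := dist_sub_le_gromovProduct p (f x) (g x)
  have h5 := dist_triangle_left (f o) (f x) p
  linarith [hC' x]

/-- Pass from `g x` to `f x`, `f y` and `g y` by the four-point inequality, using that `(x ∣ y)_o`
is at most `|x|` and `|y|`. Taking `g = f` gives the lower bound that defines the boundary map. -/
theorem IsSublinearlyBilipschitz.exists_le_gromovProduct_of_isClose_self (hX : IsHyperbolic δ X)
    (hXg : IsGeodesicSpace X) (hY : IsHyperbolic δ Y) (hYg : IsGeodesicSpace Y)
    (hu : Admissible u) (hlam : 0 < lam) (hlam' : 0 < lam')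
    (hf : IsSublinearlyBilipschitz o lam lam' C u f) (p : Y) {g : X → Y} (hg : IsClose o u f g) :
    ∃ K, ∀ x y, lam / 2 * gromovProduct o x y - K ≤ gromovProduct p (g x) (g y) := by
  have hδ := hX.nonneg o
  obtain ⟨K₁, hK₁⟩ := hf.exists_le_gromovProduct_of_isClose hu hlam p hg
  obtain ⟨C₁, hC₁, hP⟩ := hf.exists_gromovProduct_estimates hX hXg hY hYg hu hlam hlam'
  obtain ⟨K₂, -, hK₂⟩ := hu.exists_mul_le hC₁ (half_pos hlam)
  refine ⟨max K₁ (K₂ + dist (f o) p) + 2 * δ, fun x y => ?_⟩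
  have e1 := le_max_left K₁ (K₂ + dist (f o) p)
  have e2 := le_max_right K₁ (K₂ + dist (f o) p)
  have h1 := (hP x y o).1
  rw [dist_self, zero_add] at h1
  have h2 := hK₂ _ (gromovProduct_nonneg o x y)
  have h3 := gromovProduct_le_add_dist (f o) p (f x) (f y)
  have h4 := mul_le_mul_of_nonneg_left (gromovProduct_le_dist o x y) (half_pos hlam).le
  have h5 := mul_le_mul_of_nonneg_left (gromovProduct_le_dist o y x) (half_pos hlam).le
  rw [gromovProduct_comm o y] at h5
  have h6 := hK₁ x
  rw [gromovProduct_comm] at h6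
  have h7 := hY.le_of_le
    (a := lam / 2 * gromovProduct o x y - max K₁ (K₂ + dist (f o) p)) (x := g x) (y := f x)
    (z := f y) (p := p) (by linarith) (by linarith)
  have h8 := hY.le_of_le (z := g y) h7 (by linarith [hK₁ y])
  linarith

theorem isClose_refl (f : X → Y) : IsClose o u f f :=
  ⟨0, fun _ => by simp⟩

theorem IsSublinearlyBilipschitz.exists_gromovProduct_le_mul_add (hX : IsHyperbolic δ X)
    (hXg : IsGeodesicSpace X) (hY : IsHyperbolic δ Y) (hYg : IsGeodesicSpace Y)
    (hu : Admissible u) (hlam : 0 < lam) (hlam' : 0 < lam')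
    (hf : IsSublinearlyBilipschitz o lam lam' C u f) (p : Y) :
    ∃ K, ∀ x y, gromovProduct p (f x) (f y) ≤ (lam' + 1) * gromovProduct o x y + K := by
  obtain ⟨C₁, hC₁, hP⟩ := hf.exists_gromovProduct_estimates hX hXg hY hYg hu hlam hlam'
  obtain ⟨K, -, hK⟩ := hu.exists_mul_le hC₁ one_pos
  refine ⟨K + dist p (f o), fun x y => ?_⟩
  have h1 := (hP x y o).2
  rw [dist_self, zero_add] at h1
  have h2 := hK _ (gromovProduct_nonneg o x y)
  have h3 := gromovProduct_le_add_dist p (f o) (f x) (f y)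
  linarith

theorem isCauchyGromov_comp {g : X → Y} {c K : ℝ} (hc : 0 < c)
    (h : ∀ x y, c * gromovProduct o x y - K ≤ gromovProduct p (g x) (g y)) {x : ℕ → X}
    (hx : IsCauchyGromov o x) : IsCauchyGromov p (g ∘ x) :=
  tendsto_atTop_mono (fun q => h (x q.1) (x q.2))
    (tendsto_atTop_add_const_right _ (-K) (hx.const_mul_atTop hc))

/-- The boundary map of a map that expands Gromov products at least linearly. -/
def boundaryMap (g : X → Y) {c K : ℝ} (hc : 0 < c)
    (h : ∀ x y, c * gromovProduct o x y - K ≤ gromovProduct p (g x) (g y)) :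
    GromovBoundary o → GromovBoundary p :=
  Quot.lift (fun x => GromovBoundary.mk ⟨g ∘ x.1, isCauchyGromov_comp hc h x.2⟩)
    fun x y hxy => Quot.sound (tendsto_atTop_mono (fun n => h (x.1 n) (y.1 n))
      (tendsto_atTop_add_const_right _ (-K) (Tendsto.const_mul_atTop hc hxy)))

theorem boundaryMap_mk (g : X → Y) {c K : ℝ} (hc : 0 < c)
    (h : ∀ x y, c * gromovProduct o x y - K ≤ gromovProduct p (g x) (g y))
    (x : CauchyGromovSeq o) :
    boundaryMap g hc h (GromovBoundary.mk x) =
      GromovBoundary.mk ⟨g ∘ x.1, isCauchyGromov_comp hc h x.2⟩ :=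
  rfl

variable {c K c' K' : ℝ}

theorem le_boundaryProduct_boundaryMap (hX : IsHyperbolic δ X) (hY : IsHyperbolic δ Y)
    (hc : 0 < c) (h : ∀ x y, c * gromovProduct o x y - K ≤ gromovProduct p (f x) (f y))
    {ξ η : GromovBoundary o} (hne : boundaryMap f hc h ξ ≠ boundaryMap f hc h η) :
    c * (boundaryProduct ξ η).toReal - (c + K + (2 * δ + 1)) ≤
      (boundaryProduct (boundaryMap f hc h ξ) (boundaryMap f hc h η)).toReal := by
  have hξη : ξ ≠ η := fun h' => hne (congrArg _ h')
  obtain ⟨x, rfl⟩ := ξ.exists_mk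
  obtain ⟨y, rfl⟩ := η.exists_mk
  rw [boundaryMap_mk, boundaryMap_mk] at *
  obtain ⟨n, hn, hn'⟩ := ((eventually_gromovProduct_bounds hX hξη).and
    (eventually_gromovProduct_bounds hY hne)).exists
  have h1 := h (x.1 n) (y.1 n)
  have h2 := mul_le_mul_of_nonneg_left hn.1 hc.le
  have h3 := hn'.2
  simp only [Function.comp] at h3
  linarith

theorem boundaryProduct_boundaryMap_le (hX : IsHyperbolic δ X) (hY : IsHyperbolic δ Y)
    (hc : 0 < c) (h : ∀ x y, c * gromovProduct o x y - K ≤ gromovProduct p (f x) (f y))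
    (hc' : 0 < c') (h' : ∀ x y, gromovProduct p (f x) (f y) ≤ c' * gromovProduct o x y + K')
    {ξ η : GromovBoundary o} (hξη : ξ ≠ η) (hne : boundaryMap f hc h ξ ≠ boundaryMap f hc h η) :
    (boundaryProduct (boundaryMap f hc h ξ) (boundaryMap f hc h η)).toReal ≤
      c' * (boundaryProduct ξ η).toReal + (c' * (2 * δ + 1) + K' + 1) := by
  obtain ⟨x, rfl⟩ := ξ.exists_mk
  obtain ⟨y, rfl⟩ := η.exists_mk
  rw [boundaryMap_mk, boundaryMap_mk] at *
  obtain ⟨n, hn, hn'⟩ := ((eventually_gromovProduct_bounds hX hξη).and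
    (eventually_gromovProduct_bounds hY hne)).exists
  have h1 := h' (x.1 n) (y.1 n)
  have h2 := mul_le_mul_of_nonneg_left hn.2 hc'.le
  have h3 := hn'.1
  simp only [Function.comp] at h3
  linarith

theorem tendsto_gromovProduct_of_comp {ι : Type*} {l : Filter ι} (hc' : 0 < c')
    (h' : ∀ x y, gromovProduct p (f x) (f y) ≤ c' * gromovProduct o x y + K') {x y : ι → X}
    (h : Tendsto (fun i => gromovProduct p (f (x i)) (f (y i))) l atTop) :
    Tendsto (fun i => gromovProduct o (x i) (y i)) l atTop := by
  refine (tendsto_const_mul_atTop_of_pos hc').1 ?_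
  refine tendsto_atTop_mono (fun i => ?_) (tendsto_atTop_add_const_right _ (-K') h)
  linarith [h' (x i) (y i)]

theorem boundaryMap_injective (hY : IsHyperbolic δ Y) (hc : 0 < c)
    (h : ∀ x y, c * gromovProduct o x y - K ≤ gromovProduct p (f x) (f y))
    (hc' : 0 < c') (h' : ∀ x y, gromovProduct p (f x) (f y) ≤ c' * gromovProduct o x y + K') :
    Function.Injective (boundaryMap f hc h) := by
  intro ξ η hξη
  obtain ⟨x, rfl⟩ := ξ.exists_mk
  obtain ⟨y, rfl⟩ := η.exists_mk
  rw [boundaryMap_mk, boundaryMap_mk] at hξη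
  have := (GromovBoundary.mk_eq_mk_iff hY).1 hξη
  exact Quot.sound (tendsto_gromovProduct_of_comp hc' h' this)

/-- Choose `s y` with `f (s y)` within `O(u(|y|))` of `y`; then `(y ∣ f (s y))_p` grows linearly in
`|y|`. For `y` representing `η`, the sequence `f ∘ s ∘ y` also represents `η`, and the upper bound
`h'` makes `s ∘ y` Cauchy-Gromov. -/
theorem boundaryMap_surjective (hY : IsHyperbolic δ Y) (hu : Admissible u) (hc : 0 < c)
    (h : ∀ x y, c * gromovProduct o x y - K ≤ gromovProduct p (f x) (f y))
    (hc' : 0 < c') (h' : ∀ x y, gromovProduct p (f x) (f y) ≤ c' * gromovProduct o x y + K')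
    (hs : ∃ C, ∀ y, Metric.infDist y (range f) ≤ C * u (dist p y)) :
    Function.Surjective (boundaryMap f hc h) := by
  have hδ := hY.nonneg p
  obtain ⟨C, hC⟩ := hs
  have hne : (range f).Nonempty := ⟨f o, mem_range_self o⟩
  have hex : ∀ y, ∃ x, dist y (f x) < C * u (dist p y) + 1 := by
    intro y
    obtain ⟨_, ⟨x, rfl⟩, hx⟩ := (Metric.infDist_lt_iff hne).1
      ((hC y).trans_lt (lt_add_one _))
    exact ⟨x, hx⟩
  choose s hs using hex
  obtain ⟨B, hB0, hB⟩ := hu.exists_mul_le (abs_nonneg C) (half_pos one_pos)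
  have hnear : ∀ y, 1 / 2 * dist p y - (B + 1) ≤ gromovProduct p y (f (s y)) := by
    intro y
    have h0 : (0 : ℝ) ≤ dist p y := dist_nonneg
    have h1 := dist_sub_le_gromovProduct p y (f (s y))
    have h2 := mul_le_mul_of_nonneg_right (le_abs_self C) (zero_le_one.trans (hu.one_le _ h0))
    linarith [hB _ h0, hs y]
  have hnear' : ∀ y y', 1 / 2 * gromovProduct p y y' - (B + 1) - δ ≤
      gromovProduct p y (f (s y')) := by
    intro y y'
    have h1 := gromovProduct_le_dist p y' y
    have h2 := gromovProduct_nonneg p y y'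
    rw [gromovProduct_comm] at h1
    exact hY.le_of_le (y := y') (by linarith) (by linarith [hnear y'])
  intro η
  obtain ⟨y, rfl⟩ := η.exists_mk
  have hx : IsCauchyGromov o (s ∘ y.1) := by
    refine tendsto_gromovProduct_of_comp (p := p) (x := fun q : ℕ × ℕ => s (y.1 q.1))
      (y := fun q : ℕ × ℕ => s (y.1 q.2)) hc' h' ?_
    refine tendsto_atTop_mono (fun q => ?_) (tendsto_atTop_add_const_right _ (-(B + 1) - 2 * δ)
      (y.2.const_mul_atTop (half_pos one_pos)))
    have h1 := gromovProduct_le_dist p (y.1 q.1) (y.1 q.2)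
    have h2 := hnear (y.1 q.1)
    rw [gromovProduct_comm] at h2
    have h3 := hY.le_of_le
      (a := 1 / 2 * gromovProduct p (y.1 q.1) (y.1 q.2) - (B + 1) - δ)
      (by linarith : _ ≤ gromovProduct p (f (s (y.1 q.1))) (y.1 q.1)) (hnear' _ (y.1 q.2))
    linarith
  refine ⟨GromovBoundary.mk ⟨s ∘ y.1, hx⟩, Quot.sound ?_⟩
  have hy : Tendsto (fun n => gromovProduct p (y.1 n) (y.1 n)) atTop atTop :=
    y.2.comp tendsto_atTop_diagonal
  refine tendsto_atTop_mono (fun n => ?_) (tendsto_atTop_add_const_right _ (-(B + 1) - δ)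
    (hy.const_mul_atTop (half_pos one_pos)))
  have := hnear' (y.1 n) (y.1 n)
  rw [gromovProduct_comm p (y.1 n) (f _)] at this
  simp only [Function.comp]
  linarith

theorem inducesBoundaryMap_of_isClose (hu : Admissible u) (hlam : 0 < lam)
    (hf : IsSublinearlyBilipschitz o lam lam' C u f) (hc : 0 < c)
    (h : ∀ x y, c * gromovProduct o x y - K ≤ gromovProduct p (f x) (f y)) {g : X → Y}
    (hg : IsClose o u f g)
    (hgc : ∀ x y, c' * gromovProduct o x y - K' ≤ gromovProduct p (g x) (g y)) (hc' : 0 < c') :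
    InducesBoundaryMap g (boundaryMap f hc h) := by
  intro x
  refine ⟨isCauchyGromov_comp hc' hgc x.2, Quot.sound ?_⟩
  obtain ⟨B, hB⟩ := hf.exists_le_gromovProduct_of_isClose hu hlam p hg
  have hx : Tendsto (fun n => gromovProduct o (x.1 n) (x.1 n)) atTop atTop :=
    x.2.comp tendsto_atTop_diagonal
  refine tendsto_atTop_mono (fun n => ?_) (tendsto_atTop_add_const_right _ (-B)
    (hx.const_mul_atTop (half_pos hlam)))
  have h1 := hB (x.1 n)
  have h2 := mul_le_mul_of_nonneg_left (gromovProduct_le_dist o (x.1 n) (x.1 n)) (half_pos hlam).le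
  simp only [Function.comp]
  linarith

/-- The quasiMöbius inequality for boundary maps, with the error at any upper bound for the Gromov
products of the four points. -/
theorem IsSublinearlyBilipschitz.exists_logPlus_crossRatio_estimates (hX : IsHyperbolic δ X)
    (hXg : IsGeodesicSpace X) (hY : IsHyperbolic δ Y) (hYg : IsGeodesicSpace Y)
    {ν : ℝ} (hν : 1 < ν) (hνδ : ν ^ δ ≤ 2)
    (hu : Admissible u) (hlam : 0 < lam) (hlam' : 0 < lam')
    (hf : IsSublinearlyBilipschitz o lam lam' C u f) (hc : 0 < c)
    (h : ∀ x y, c * gromovProduct o x y - K ≤ gromovProduct p (f x) (f y))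
    (hinj : Function.Injective (boundaryMap f hc h)) :
    letI : MetricSpace (GromovBoundary o) := visualMetric o hX hν hνδ
    letI : MetricSpace (GromovBoundary p) := visualMetric p hY hν hνδ
    ∃ C', ∀ (ξ : Fin 4 → GromovBoundary o) (M : ℝ), 0 ≤ M → Function.Injective ξ →
      (∀ i j, i ≠ j → (boundaryProduct (ξ i) (ξ j)).toReal ≤ M) →
      lam * logPlus ν (crossRatio ξ) - C' * u M ≤
        logPlus ν (crossRatio (boundaryMap f hc h ∘ ξ)) ∧
      logPlus ν (crossRatio (boundaryMap f hc h ∘ ξ)) ≤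
        lam' * logPlus ν (crossRatio ξ) + C' * u M := by
  let : MetricSpace (GromovBoundary o) := visualMetric o hX hν hνδ
  let : MetricSpace (GromovBoundary p) := visualMetric p hY hν hνδ
  have hδ := hX.nonneg o
  obtain ⟨C₁, hC₁, hP⟩ := hf.exists_crossDifference_estimates hX hXg hY hYg hu hlam hlam' p
  obtain ⟨D, hD1, hD⟩ := hu.exists_le_mul 1 (2 * δ + 1)
  -- The error between the logarithm of a cross-ratio and the cross-difference of interior points:
  -- four products, each off by `2 * δ + 1`, plus the comparison of distances with products.
  set T := 4 * (2 * δ + 1) + 2 * Real.logb ν 4 with hT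
  have hT0 : 0 ≤ T := by
    have := Real.logb_nonneg hν (by norm_num : (1 : ℝ) ≤ 4)
    positivity
  refine ⟨C₁ * D + (1 + lam + lam') * T, fun ξ M hM hξ hξM => ?_⟩
  have huM := hu.one_le M hM
  set φ := boundaryMap f hc h with hφ
  choose x hx using fun i => (ξ i).exists_mk
  have hne : ∀ i j, i ≠ j → ξ i ≠ ξ j := fun i j hij h => hij (hξ h)
  have hne' : ∀ i j, i ≠ j → φ (ξ i) ≠ φ (ξ j) := fun i j hij h => hij (hξ (hinj h))
  have hev : ∀ᶠ n in atTop, ∀ i j, i ≠ j →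
      |gromovProduct o ((x i).1 n) ((x j).1 n) - (boundaryProduct (ξ i) (ξ j)).toReal| ≤
        2 * δ + 1 ∧
      |gromovProduct p (f ((x i).1 n)) (f ((x j).1 n)) -
        (boundaryProduct (φ (ξ i)) (φ (ξ j))).toReal| ≤ 2 * δ + 1 := by
    refine eventually_all.2 fun i => eventually_all.2 fun j => ?_
    by_cases hij : i = j
    · exact Eventually.of_forall fun n h => absurd hij h
    have h1 := hne i j hij
    have h2 := hne' i j hij
    rw [← hx i, ← hx j] at h1 h2 ⊢
    rw [hφ, boundaryMap_mk, boundaryMap_mk] at *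
    filter_upwards [eventually_gromovProduct_bounds hX h1, eventually_gromovProduct_bounds hY h2]
      with n hn hn' _
    simp only [Function.comp] at hn'
    exact ⟨abs_le.2 ⟨by linarith, by linarith⟩, abs_le.2 ⟨by linarith, by linarith⟩⟩
  -- A single index serves all pairs at once, in `X` and in `Y`. This reduces the boundary statement
  -- to four points of `X`.
  obtain ⟨n, hn⟩ := hev.exists
  have hest := hP (fun i => (x i).1 n) (M + (2 * δ + 1)) (by positivity) fun i j hij => by
    linarith [(abs_le.1 (hn i j hij).1).2, hξM i j hij]
  have hmax : ∀ s t : ℝ, |s - t| ≤ T → max 0 s ≤ max 0 t + T ∧ max 0 t ≤ max 0 s + T := by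
    intro s t hst
    rw [abs_le] at hst
    constructor <;> refine max_le ?_ ?_ <;>
      linarith [le_max_left 0 s, le_max_right 0 s, le_max_left 0 t, le_max_right 0 t]
  have hA := abs_crossDifference_sub_le fun i j hij => (hn i j hij).1
  have hB := abs_crossDifference_sub_le fun i j hij => (hn i j hij).2
  have hA' := abs_logb_crossRatio_sub_le hν fun i j hij =>
    visualMetric_dist_bounds hX hν hνδ (hne i j hij)
  have hB' : |Real.logb ν (crossRatio (φ ∘ ξ)) -
      crossDifference fun i j => (boundaryProduct (φ (ξ i)) (φ (ξ j))).toReal| ≤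
        2 * Real.logb ν 4 := abs_logb_crossRatio_sub_le hν fun i j hij =>
    visualMetric_dist_bounds hY hν hνδ (hne' i j hij)
  rw [abs_sub_comm] at hA hB
  have e1 := hmax _ _ ((abs_sub_le _ _ _).trans ((add_le_add hA' hA).trans_eq (by rw [hT]; ring)))
  have e2 := hmax _ _ ((abs_sub_le _ _ _).trans ((add_le_add hB' hB).trans_eq (by rw [hT]; ring)))
  have e3 := mul_le_mul_of_nonneg_left
    (hD M (M + (2 * δ + 1)) hM (by positivity) (by linarith)) hC₁
  have e4 : (1 + lam + lam') * T ≤ (1 + lam + lam') * T * u M :=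
    le_mul_of_one_le_right (by positivity) huM
  have e5 := mul_le_mul_of_nonneg_left e1.1 hlam.le
  have e6 := mul_le_mul_of_nonneg_left e1.2 hlam'.le
  have e7 : 0 ≤ lam * T := by positivity
  have e8 : 0 ≤ lam' * T := by positivity
  simp only [logPlus]
  constructor <;> linarith

end BoundaryMap

end SublinearMobius

end

/-! ### The boundary homeomorphism -/

open SublinearMobius in
theorem mainTheorem1 {X Y : Type*} [MetricSpace X] [ProperSpace X] [MetricSpace Y] [ProperSpace Y]
    (hXgeo : IsGeodesicSpace X) (hYgeo : IsGeodesicSpace Y) (oX : X) (oY : Y)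
    {δ : ℝ} (hX : IsHyperbolic δ X) (hY : IsHyperbolic δ Y)
    {ν : ℝ} (hν : 1 < ν) (hνδ : ν ^ δ ≤ 2)
    {u : ℝ → ℝ} (hu : Admissible u)
    {lamLow lamUp : ℝ} (hlamLow : 0 < lamLow) (hlamUp : 0 < lamUp)
    (f : X → Y) (hf : IsSBE oX oY lamLow lamUp u f) :
    letI : MetricSpace (GromovBoundary oX) := visualMetric oX hX hν hνδ
    letI : MetricSpace (GromovBoundary oY) := visualMetric oY hY hν hνδ
    ∃ φ : GromovBoundary oX ≃ₜ GromovBoundary oY,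
      (∀ g : X → Y, IsClose oX u f g → InducesBoundaryMap g φ) ∧
      IsSublinearlyQuasiMobius lamLow lamUp u φ ∧
      ∃ v : ℝ → ℝ, v =O[atTop] u ∧ ∃ E : ℝ, 0 < E ∧
        ∀ ξ : Fin 4 → GromovBoundary oX, Function.Injective ξ →
          (∀ i j, dist (ξ i) (ξ j) < E) →
          lamLow * logPlus ν (crossRatio ξ)
              - v (supPairs fun i j => (boundaryProduct (ξ i) (ξ j)).toReal)
            ≤ logPlus ν (crossRatio (φ ∘ ξ)) ∧
          logPlus ν (crossRatio (φ ∘ ξ))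
            ≤ lamUp * logPlus ν (crossRatio ξ)
              + v (supPairs fun i j => (boundaryProduct (ξ i) (ξ j)).toReal) := by
  let : MetricSpace (GromovBoundary oX) := visualMetric oX hX hν hνδ
  let : MetricSpace (GromovBoundary oY) := visualMetric oY hY hν hνδ
  obtain ⟨C, hfC⟩ := hf.exists_isSublinearlyBilipschitz hu
  have hc : 0 < lamLow / 2 := half_pos hlamLow
  have hc' : 0 < lamUp + 1 := by linarith
  obtain ⟨K, hK⟩ := hfC.exists_le_gromovProduct_of_isClose_self hX hXgeo hY hYgeo hu hlamLow
    hlamUp oY (isClose_refl f)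
  obtain ⟨K', hK'⟩ := hfC.exists_gromovProduct_le_mul_add hX hXgeo hY hYgeo hu hlamLow hlamUp oY
  have hinj := boundaryMap_injective hY hc hK hc' hK'
  have hsurj := boundaryMap_surjective hY hu hc hK hc' hK' hf.surjective
  let e : GromovBoundary oX ≃ GromovBoundary oY := Equiv.ofBijective _ ⟨hinj, hsurj⟩
  have hcont : Continuous e := continuous_of_boundaryProduct hX hY hν hνδ hc e
    fun ξ η hne => le_boundaryProduct_boundaryMap hX hY hc hK hne
  have hcont' : Continuous e.symm := by
    -- The upper bound `boundaryProduct_boundaryMap_le`, solved for the product in the source, is a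
    -- lower bound for the inverse map.
    refine continuous_of_boundaryProduct hY hX hν hνδ (c := (lamUp + 1)⁻¹)
      (K := (lamUp + 1)⁻¹ * ((lamUp + 1) * (2 * δ + 1) + K' + 1)) (inv_pos.2 hc') e.symm
      fun ξ η hne => ?_
    have hξη : e (e.symm ξ) ≠ e (e.symm η) := fun h => hne (e.injective h)
    have h1 := boundaryProduct_boundaryMap_le hX hY hc hK hc' hK' hne hξη
    change (boundaryProduct (e (e.symm ξ)) (e (e.symm η))).toReal ≤ _ at h1
    rw [e.apply_symm_apply, e.apply_symm_apply] at h1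
    rw [← mul_sub, inv_mul_le_iff₀ hc']
    linarith
  obtain ⟨C', hC'⟩ := hfC.exists_logPlus_crossRatio_estimates hX hXgeo hY hYgeo hν hνδ hu hlamLow
    hlamUp hc hK hinj
  have hbigO : (fun r => C' * u r) =O[atTop] u := isBigO_const_mul_self C' u atTop
  refine ⟨⟨e, hcont, hcont'⟩, fun g hg => ?_, ?_, ?_⟩
  · obtain ⟨K'', hK''⟩ := hfC.exists_le_gromovProduct_of_isClose_self hX hXgeo hY hYgeo hu hlamLow
      hlamUp oY hg
    exact inducesBoundaryMap_of_isClose hu hlamLow hfC hc hK hg hK'' hc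
  · refine ⟨fun r => C' * u r, hbigO, ν, hν, 1, one_pos, fun ξ hξ => ?_⟩
    have hne : ∀ i j, i ≠ j → ξ i ≠ ξ j := fun i j hij => dist_pos.1 (hξ i j hij).1
    -- Since the visual distance is at most the kernel, `-logb ν` of the distance dominates the
    -- Gromov product. The supremum is therefore an admissible value of `M`, and it is nonnegative.
    have hle : ∀ i j, i ≠ j → (boundaryProduct (ξ i) (ξ j)).toReal ≤
        supPairs fun i j => -Real.logb ν (dist (ξ i) (ξ j)) := fun i j hij => by
      have h1 := visualMetric_dist_bounds hX hν hνδ (hne i j hij)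
      have h2 := (logb_dist_bounds hν h1.1 h1.2).2
      have h3 := le_supPairs (fun i j => -Real.logb ν (dist (ξ i) (ξ j))) hij
      linarith
    exact hC' ξ _ ((toReal_boundaryProduct_nonneg _ _).trans (hle 0 1 (by decide)))
      (fun i j h => by_contra fun hij => hne i j hij h) hle
  · refine ⟨fun r => C' * u r, hbigO, 1, one_pos, fun ξ hξ _ => ?_⟩
    have hle : ∀ i j, i ≠ j → (boundaryProduct (ξ i) (ξ j)).toReal ≤
        supPairs fun i j => (boundaryProduct (ξ i) (ξ j)).toReal := fun i j hij =>
      le_supPairs (fun i j => (boundaryProduct (ξ i) (ξ j)).toReal) hij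
    exact hC' ξ _ ((toReal_boundaryProduct_nonneg _ _).trans (hle 0 1 (by decide))) hξ hle
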